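/- Let $m\ge 1$ be an integer, let $p\in[1,\infty)$, put $\alpha=2(p-1)/m$, and let $\Omega\subseteq\mathbb{R}^m$ be a non-empty, open, connected set. Let $\rho:\Omega\to\mathbb{R}$ be a $C^\infty$ function such that $1/\beta\le\rho\le\beta$ on $\Omega$ for some $\beta>0$, $\rho$ is Lipschitz on $\Omega$ with respect to the geodesic distance of $\Omega$ (the infimum of the Euclidean lengths of the piecewise $C^1$ paths in $\Omega$ between two points), and the Hessian $H$ of $\rho$ is bounded on $\Omega$. For $x,y\in\Omega$ let $$\mathcal{L}_p(x,y)=\Big(\inf_\gamma\int_0^1\frac{\|\gamma'(t)\|}{\rho(\gamma(t))^{(p-1)/m}}\,dt\Big)^{1/p},$$ where $\gamma$ ranges over the piecewise $C^1$ paths $\gamma:[0,1]\to\Omega$ with $\gamma(0)=x$ and $\gamma(1)=y$. Then for $x,y\in\Omega$ with $x\ne y$ and $u=(y-x)/\|y-x\|$, as $y\to x$, $$\|y-x\|=\rho(x)^{\frac{p-1}{m}}\mathcal{L}_p^p(x,y)+\frac12\Big(\frac{p-1}{m}\Big)\langle u,\nabla\rho(x)\rangle\,\rho(x)^{\frac{2(p-1)}{m}-1}\mathcal{L}_p^{2p}(x,y)+C\,\mathcal{L}_p^{3p}(x,y)+O\big(\mathcal{L}_p^{4p}(x,y)\big),$$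 where $$C=\rho(x)^{\frac32\alpha-2}\Big[\frac{\alpha^2}{96}\langle\nabla\rho(x),\nabla\rho(x)\rangle+\Big(\frac{7\alpha^2}{96}-\frac{\alpha}{12}\Big)\langle u,\nabla\rho(x)\rangle^2+\frac{\alpha}{12}\rho(x)\langle H(x)u,u\rangle\Big],$$ and $$\mathcal{L}_p^p(x,y)=\frac{1}{\rho(x)^{\frac{p-1}{m}}}\Big(\|y-x\|-\frac12\Big(\frac{p-1}{m}\Big)\Big\langle u,\frac{\nabla\rho(x)}{\rho(x)}\Big\rangle\|y-x\|^2\Big)+O\big(\|y-x\|^3\big).$$ The error terms are uniform for $x$ in compact subsets of $\Omega$: for every compact $K\subseteq\Omega$ there are $M,\delta>0$ such that, for all $x\in K$ and $y\in\Omega$ with $0<\|y-x\|<\delta$, the two error terms are at most $M\mathcal{L}_p^{4p}(x,y)$ and $M\|y-x\|^3$ in absolute value, respectively. -/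

import Mathlib

open scoped ContDiff

noncomputable section

/-- `γ` restricted to `[0,1]` is a piecewise `C¹` path in `Ω` from `x` to `y`: it is continuous on
`[0,1]`, takes its values in `Ω`, and `[0,1]` has a finite subdivision such that `γ` is `C¹` on each
closed piece (with one-sided derivatives at the ends of the piece). -/
structure IsPiecewiseC1Path {m : ℕ} (Ω : Set (EuclideanSpace ℝ (Fin m)))
    (x y : EuclideanSpace ℝ (Fin m)) (γ : ℝ → EuclideanSpace ℝ (Fin m)) : Prop where
  source : γ 0 = x
  target : γ 1 = y
  mapsTo : Set.MapsTo γ (Set.Icc 0 1) Ω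
  continuousOn : ContinuousOn γ (Set.Icc 0 1)
  piecewise : ∃ (n : ℕ) (t : ℕ → ℝ), t 0 = 0 ∧ t n = 1 ∧
    (∀ i < n, t i < t (i + 1)) ∧
    ∀ i < n, ContDiffOn ℝ 1 γ (Set.Icc (t i) (t (i + 1)))

/-- The infimum over the piecewise `C¹` paths `γ` in `Ω` from `x` to `y` of
`∫₀¹ w(γ(t)) ‖γ'(t)‖ dt`. At the finitely many break points `deriv γ` may take
the default value `0`, which does not affect the integral. -/
def weightedPathDist {m : ℕ} (Ω : Set (EuclideanSpace ℝ (Fin m)))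
    (w : EuclideanSpace ℝ (Fin m) → ℝ) (x y : EuclideanSpace ℝ (Fin m)) : ℝ :=
  sInf {ℓ : ℝ | ∃ γ : ℝ → EuclideanSpace ℝ (Fin m), IsPiecewiseC1Path Ω x y γ ∧
    ℓ = ∫ t in (0 : ℝ)..1, w (γ t) * ‖deriv γ t‖}

/-- The geodesic distance of `Ω` with the Euclidean metric. -/
def geodesicDist {m : ℕ} (Ω : Set (EuclideanSpace ℝ (Fin m)))
    (x y : EuclideanSpace ℝ (Fin m)) : ℝ :=
  weightedPathDist Ω (fun _ => 1) x y

/-- The continuum `p`-weighted Fermat distance `𝓛_p(x, y)` on the flat domain `Ω` with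
density `ρ`. -/
def fermatDist {m : ℕ} (Ω : Set (EuclideanSpace ℝ (Fin m)))
    (ρ : EuclideanSpace ℝ (Fin m) → ℝ) (p : ℝ) (x y : EuclideanSpace ℝ (Fin m)) : ℝ :=
  (weightedPathDist Ω (fun z => 1 / ρ z ^ ((p - 1) / (m : ℝ))) x y) ^ (1 / p)

/-- The Hessian of `ρ` at `x`, as a linear operator: the derivative of the gradient. -/
def hessian {m : ℕ} (ρ : EuclideanSpace ℝ (Fin m) → ℝ) (x : EuclideanSpace ℝ (Fin m)) :
    EuclideanSpace ℝ (Fin m) →L[ℝ] EuclideanSpace ℝ (Fin m) :=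
  fderiv ℝ (gradient ρ) x

/-- The standing assumptions on the density `ρ` on `Ω`: it is bounded above and away from zero,
smooth, Lipschitz for the geodesic distance, and has a bounded Hessian. -/
structure IsRegularDensity {m : ℕ} (Ω : Set (EuclideanSpace ℝ (Fin m)))
    (ρ : EuclideanSpace ℝ (Fin m) → ℝ) : Prop where
  bounded : ∃ β : ℝ, 0 < β ∧ ∀ x ∈ Ω, 1 / β ≤ ρ x ∧ ρ x ≤ β
  smooth : ContDiffOn ℝ ∞ ρ Ω
  lipschitz : ∃ L₁ : ℝ, ∀ x ∈ Ω, ∀ y ∈ Ω, |ρ x - ρ y| ≤ L₁ * geodesicDist Ω x y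
  hessian_bounded : ∃ L₂ : ℝ, ∀ x ∈ Ω, ‖hessian ρ x‖ ≤ L₂

/-- The coefficient `C` of `𝓛_p^{3p}(x, y)`, in terms of `α`, the point `x` and the direction `u`. -/
def cubicCoeff {m : ℕ} (ρ : EuclideanSpace ℝ (Fin m) → ℝ) (α : ℝ)
    (x u : EuclideanSpace ℝ (Fin m)) : ℝ :=
  ρ x ^ (3 / 2 * α - 2) *
    (α ^ 2 / 96 * inner ℝ (gradient ρ x) (gradient ρ x)
      + (7 * α ^ 2 / 96 - α / 12) * (inner ℝ u (gradient ρ x)) ^ 2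
      + α / 12 * ρ x * inner ℝ (hessian ρ x u) u)

end

/-!
The Fermat distance satisfies `𝓛_p ^ p = D`, where `D` is the distance of the conformally flat
metric with weight `w = ρ ^ (-a)`, `a = (p - 1) / m`. The theorem follows from a third-order
expansion of such a distance, uniform in the base point: with `g = ∇w(x)`, `H = D²w(x)` and
`y = x + r u`, `‖u‖ = 1`,

`D(x, y) = w r + ⟪g, u⟫ r² / 2 + (H(u, u) / 6 - ‖g⊥‖² / (24 w)) r³ + O(r⁴)`,

where `g⊥` is the part of `g` orthogonal to `u`. The second expansion of the theorem is its
truncation, and the first is its inverse series, after the derivatives of `w` are written in terms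
of those of `ρ`.

*Upper bound* (`HasCubicTaylorBound.weightedPathDist_le`). The path
`t ↦ x + t r u + (t (t - 1) / 2) r² g⊥ / w` solves the geodesic equation to leading order, and its
length is the expansion above up to `O(r⁴)`.

*Lower bound* (`HasCubicTaylorBound.distExpansion_le`). An explicit cubic polynomial `F`
(`calibration`) satisfies `F(y) - F(x) =` the expansion above, and `‖∇F‖ ≤ (1 + O(r³)) w` on a ball
of radius comparable to `r` about `x`. Hence every path in this ball has length at least
`(1 - O(r³)) (F(y) - F(x))` by the fundamental theorem of calculus
(`IsPiecewiseC1Path.sub_le_integral`). A path that leaves the ball is longer than the expansion,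
because `w` is bounded below on all of `Ω`. With `s = ⟪u, z - x⟫` and `η = z - x - s u`, the point
of the choice of `F` is that
`∂F/∂s = T - κ (s - r/2)² / 2` and `∂F/∂η = (s - r/2) g⊥ + O(r²)`, with `T` the second-order Taylor
polynomial of `w` and `κ = ‖g⊥‖² / w`, so that the second-order contributions of `κ` and `g⊥` to
`‖∇F‖²` cancel.

Uniformity comes from the Taylor bounds of `exists_hasCubicTaylorBound`, whose constants depend only
on a compact neighbourhood of `K` in `Ω`; all later constants are polynomials in these.
-/

/-! ### Lengths of piecewise `C¹` paths -/

namespace IsPiecewiseC1Path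

variable {m : ℕ} {Ω : Set (EuclideanSpace ℝ (Fin m))} {x y : EuclideanSpace ℝ (Fin m)}
  {γ : ℝ → EuclideanSpace ℝ (Fin m)} {w : EuclideanSpace ℝ (Fin m) → ℝ}

theorem partition_mono {n : ℕ} {t : ℕ → ℝ} (ht : ∀ i < n, t i < t (i + 1)) {i j : ℕ}
    (hij : i ≤ j) (hj : j ≤ n) : t i ≤ t j := by
  induction j, hij using Nat.le_induction with
  | base => exact le_rfl
  | succ k _ ih => exact (ih (by omega)).trans (ht k (by omega)).le

theorem intervalIntegrable (hγ : IsPiecewiseC1Path Ω x y γ) (hw : ContinuousOn w Ω) :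
    IntervalIntegrable (fun t => w (γ t) * ‖deriv γ t‖) MeasureTheory.volume 0 1 := by
  obtain ⟨n, t, h0, h1, hlt, hC⟩ := hγ.piecewise
  rw [← h0, ← h1]
  refine IntervalIntegrable.trans_iterate fun k hk => ?_
  have hsub : Set.Icc (t k) (t (k + 1)) ⊆ Set.Icc 0 1 := by
    refine Set.Icc_subset_Icc ?_ ?_
    · rw [← h0]; exact partition_mono hlt (Nat.zero_le k) hk.le
    · rw [← h1]; exact partition_mono hlt hk le_rfl
  have hd : ContinuousOn (derivWithin γ (Set.Icc (t k) (t (k + 1)))) (Set.Icc (t k) (t (k + 1))) :=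
    (hC k hk).continuousOn_derivWithin (uniqueDiffOn_Icc (hlt k hk)) le_rfl
  have hc : ContinuousOn
      (fun s => w (γ s) * ‖derivWithin γ (Set.Icc (t k) (t (k + 1))) s‖)
      (Set.uIcc (t k) (t (k + 1))) := by
    rw [Set.uIcc_of_le (hlt k hk).le]
    exact ((hw.comp hγ.continuousOn hγ.mapsTo).mono hsub).mul hd.norm
  refine hc.intervalIntegrable.congr_uIoo fun s hs => ?_
  rw [Set.uIoo_of_le (hlt k hk).le] at hs
  simp only [derivWithin_of_mem_nhds (Icc_mem_nhds hs.1 hs.2)]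

/-- Calibration: a function whose derivative along `γ` is bounded by the weight cannot increase
along `γ` by more than the weighted length. -/
theorem sub_le_integral (hγ : IsPiecewiseC1Path Ω x y γ) (hw : ContinuousOn w Ω)
    {F : EuclideanSpace ℝ (Fin m) → ℝ}
    {F' : EuclideanSpace ℝ (Fin m) → EuclideanSpace ℝ (Fin m) →L[ℝ] ℝ}
    (hF : ∀ z, HasFDerivAt F (F' z) z)
    (hle : ∀ s ∈ Set.Icc (0 : ℝ) 1, ∀ v, F' (γ s) v ≤ w (γ s) * ‖v‖)
    {τ : ℝ} (hτ : τ ∈ Set.Icc (0 : ℝ) 1) :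
    F (γ τ) - F x ≤ ∫ s in (0 : ℝ)..τ, w (γ s) * ‖deriv γ s‖ := by
  have hint := hγ.intervalIntegrable hw
  obtain ⟨n, t, h0, h1, hlt, hC⟩ := hγ.piecewise
  have ht0 : ∀ k ≤ n, 0 ≤ t k := fun k hk => by
    rw [← h0]; exact partition_mono hlt (Nat.zero_le k) hk
  have hmem : ∀ k ≤ n, min (t k) τ ∈ Set.Icc (0 : ℝ) 1 := fun k hk =>
    ⟨le_min (ht0 k hk) hτ.1, (min_le_right _ _).trans hτ.2⟩
  have hsub : ∀ {a b : ℝ}, a ∈ Set.Icc (0 : ℝ) 1 → b ∈ Set.Icc (0 : ℝ) 1 →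
      IntervalIntegrable (fun t => w (γ t) * ‖deriv γ t‖) MeasureTheory.volume a b :=
    fun ha hb => hint.mono_set (by
      rw [Set.uIcc_of_le (zero_le_one' ℝ)]
      exact Set.uIcc_subset_Icc ha hb)
  have key : ∀ k ≤ n, F (γ (min (t k) τ)) - F x ≤
      ∫ s in (0 : ℝ)..(min (t k) τ), w (γ s) * ‖deriv γ s‖ := by
    intro k
    induction k with
    | zero => intro _; simp [h0, min_eq_left hτ.1, hγ.source]
    | succ k ih =>
      intro hk
      have hle' : min (t k) τ ≤ min (t (k + 1)) τ := min_le_min_right _ (hlt k hk).le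
      have hstep : F (γ (min (t (k + 1)) τ)) - F (γ (min (t k) τ)) ≤
          ∫ s in (min (t k) τ)..(min (t (k + 1)) τ), w (γ s) * ‖deriv γ s‖ := by
        have hIcc : Set.Icc (min (t k) τ) (min (t (k + 1)) τ) ⊆ Set.Icc 0 1 :=
          Set.Icc_subset_Icc (hmem k (by omega)).1 (hmem (k + 1) hk).2
        refine intervalIntegral.sub_le_integral_of_hasDeriv_right_of_le hle'
          (g := fun s => F (γ s)) (g' := fun s => F' (γ s) (deriv γ s)) ?_ ?_ ?_ ?_
        · have hFc : Continuous F := continuous_iff_continuousAt.2 fun z => (hF z).continuousAt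
          exact hFc.comp_continuousOn (hγ.continuousOn.mono hIcc)
        · intro s hs
          have hs1 : t k < s := by
            rcases min_lt_iff.1 hs.1 with h | h
            · exact h
            · exact absurd (hs.2.trans_le (min_le_right _ _)) (not_lt.2 h.le)
          have hs2 : s < t (k + 1) := hs.2.trans_le (min_le_left _ _)
          have hd : DifferentiableAt ℝ γ s :=
            ((hC k hk).differentiableOn one_ne_zero).differentiableAt (Icc_mem_nhds hs1 hs2)
          exact ((hF (γ s)).comp_hasDerivAt s hd.hasDerivAt).hasDerivWithinAt
        · exact (intervalIntegrable_iff_integrableOn_Icc_of_le hle').1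
            (hsub (hmem k (by omega)) (hmem (k + 1) hk))
        · intro s hs
          exact hle s (hIcc (Set.Ioo_subset_Icc_self hs)) _
      have hadd := intervalIntegral.integral_add_adjacent_intervals
        (hsub (Set.left_mem_Icc.2 zero_le_one) (hmem k (by omega)))
        (hsub (hmem k (by omega)) (hmem (k + 1) hk))
      linarith [ih (by omega)]
  have := key n le_rfl
  rwa [h1, min_eq_right hτ.2] at this

/-- With a weight bounded below by `c`, the weighted length is at least `c` times the distance from
the starting point to any point on the path. -/
theorem mul_norm_sub_le_integral (hγ : IsPiecewiseC1Path Ω x y γ) (hw : ContinuousOn w Ω)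
    {c : ℝ} (hc : 0 ≤ c) (hcw : ∀ z ∈ Ω, c ≤ w z) {τ : ℝ} (hτ : τ ∈ Set.Icc (0 : ℝ) 1) :
    c * ‖γ τ - x‖ ≤ ∫ s in (0 : ℝ)..1, w (γ s) * ‖deriv γ s‖ := by
  set e : EuclideanSpace ℝ (Fin m) := (‖γ τ - x‖)⁻¹ • (γ τ - x)
  have he : ‖e‖ ≤ 1 := by
    rw [norm_smul, norm_inv, norm_norm]
    exact inv_mul_le_one
  have h1 := hγ.sub_le_integral hw (F := fun z => c * inner ℝ e z)
    (F' := fun _ => c • innerSL ℝ e)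
    (fun z => ((innerSL ℝ e).hasFDerivAt (x := z)).const_mul c)
    (fun s hs v => by
      have h2 : inner ℝ e v ≤ ‖v‖ := (real_inner_le_norm e v).trans
        (mul_le_of_le_one_left (norm_nonneg v) he)
      calc (c • innerSL ℝ e) v = c * inner ℝ e v := by simp
        _ ≤ c * ‖v‖ := by gcongr
        _ ≤ w (γ s) * ‖v‖ := by gcongr; exact hcw _ (hγ.mapsTo hs)) hτ
  have h2 : c * inner ℝ e (γ τ) - c * inner ℝ e x = c * ‖γ τ - x‖ := by
    rw [← mul_sub, ← inner_sub_right]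
    congr 1
    rw [real_inner_smul_left, real_inner_self_eq_norm_sq]
    by_cases h : ‖γ τ - x‖ = 0
    · simp [h]
    · field_simp
  rw [h2] at h1
  refine h1.trans (intervalIntegral.integral_mono_interval le_rfl hτ.1 hτ.2 ?_
    (hγ.intervalIntegrable hw))
  rw [Filter.EventuallyLE, MeasureTheory.ae_restrict_iff' measurableSet_Ioc]
  refine Filter.Eventually.of_forall fun s hs => ?_
  exact mul_nonneg (hc.trans (hcw _ (hγ.mapsTo ⟨hs.1.le, hs.2⟩))) (norm_nonneg _)

end IsPiecewiseC1Path

section PathDistance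

variable {m : ℕ} {Ω : Set (EuclideanSpace ℝ (Fin m))} {x y : EuclideanSpace ℝ (Fin m)}
  {γ : ℝ → EuclideanSpace ℝ (Fin m)} {w : EuclideanSpace ℝ (Fin m) → ℝ}

theorem weightedLength_nonneg (hγ : IsPiecewiseC1Path Ω x y γ) (hw : ∀ z ∈ Ω, 0 ≤ w z) :
    0 ≤ ∫ t in (0 : ℝ)..1, w (γ t) * ‖deriv γ t‖ :=
  intervalIntegral.integral_nonneg zero_le_one fun _ ht =>
    mul_nonneg (hw _ (hγ.mapsTo ht)) (norm_nonneg _)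

theorem weightedPathDist_nonneg (hw : ∀ z ∈ Ω, 0 ≤ w z) : 0 ≤ weightedPathDist Ω w x y := by
  refine Real.sInf_nonneg ?_
  rintro _ ⟨γ, hγ, rfl⟩
  exact weightedLength_nonneg hγ hw

theorem weightedPathDist_le (hw : ∀ z ∈ Ω, 0 ≤ w z) (hγ : IsPiecewiseC1Path Ω x y γ) :
    weightedPathDist Ω w x y ≤ ∫ t in (0 : ℝ)..1, w (γ t) * ‖deriv γ t‖ := by
  refine csInf_le ⟨0, ?_⟩ ⟨γ, hγ, rfl⟩
  rintro _ ⟨γ', hγ', rfl⟩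
  exact weightedLength_nonneg hγ' hw

theorem le_weightedPathDist (hγ : IsPiecewiseC1Path Ω x y γ) {b : ℝ}
    (hb : ∀ γ', IsPiecewiseC1Path Ω x y γ' → b ≤ ∫ t in (0 : ℝ)..1, w (γ' t) * ‖deriv γ' t‖) :
    b ≤ weightedPathDist Ω w x y := by
  refine le_csInf ⟨_, γ, hγ, rfl⟩ ?_
  rintro _ ⟨γ', hγ', rfl⟩
  exact hb γ' hγ'

theorem isPiecewiseC1Path_of_contDiff (hγ : ContDiff ℝ 1 γ)
    (hmaps : Set.MapsTo γ (Set.Icc 0 1) Ω) : IsPiecewiseC1Path Ω (γ 0) (γ 1) γ where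
  source := rfl
  target := rfl
  mapsTo := hmaps
  continuousOn := hγ.continuous.continuousOn
  piecewise := ⟨1, fun i => i, by simp, by simp, fun _ _ => by simp, fun _ _ => hγ.contDiffOn⟩

end PathDistance

/-! ### Second-order expansions of the weight -/

/-- A second-order expansion of the weight `w` at `x` on the ball of radius `ε`, contained in `Ω`,
with gradient `g` and second derivative `H`. The single number `N` bounds all coefficients, the
cubic remainder, and the inverse of the weight on the whole of `Ω`. The bilinear map `H` need not
be symmetric. -/
structure HasCubicTaylorBound {m : ℕ} (Ω : Set (EuclideanSpace ℝ (Fin m)))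
    (w : EuclideanSpace ℝ (Fin m) → ℝ) (x g : EuclideanSpace ℝ (Fin m))
    (H : EuclideanSpace ℝ (Fin m) →L[ℝ] EuclideanSpace ℝ (Fin m) →L[ℝ] ℝ) (N ε : ℝ) : Prop where
  one_le : 1 ≤ N
  weight_le : w x ≤ N
  one_le_mul_weight : ∀ z ∈ Ω, 1 ≤ N * w z
  grad_le : ‖g‖ ≤ N
  grad_div_le : ‖g‖ / w x ≤ N
  hess_le : ‖H‖ ≤ N
  mem : ∀ z, ‖z‖ ≤ ε → x + z ∈ Ω
  expansion : ∀ z, ‖z‖ ≤ ε → |w (x + z) - (w x + inner ℝ g z + H z z / 2)| ≤ N * ‖z‖ ^ 3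

theorem HasCubicTaylorBound.weight_pos {m : ℕ} {Ω : Set (EuclideanSpace ℝ (Fin m))}
    {w : EuclideanSpace ℝ (Fin m) → ℝ} {x g : EuclideanSpace ℝ (Fin m)}
    {H : EuclideanSpace ℝ (Fin m) →L[ℝ] EuclideanSpace ℝ (Fin m) →L[ℝ] ℝ} {N ε : ℝ}
    (hT : HasCubicTaylorBound Ω w x g H N ε) : ∀ z ∈ Ω, 0 < w z := fun z hz =>
  pos_of_mul_pos_right (zero_lt_one.trans_le (hT.one_le_mul_weight z hz))
    (zero_le_one.trans hT.one_le)

/-- The third-order expansion of the weighted distance from `x` to `x + r u`, where `w`, `g`, `H`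
are the value, the gradient and the second derivative of the weight at `x`. -/
noncomputable def distExpansion {m : ℕ} (w : ℝ) (g : EuclideanSpace ℝ (Fin m))
    (H : EuclideanSpace ℝ (Fin m) →L[ℝ] EuclideanSpace ℝ (Fin m) →L[ℝ] ℝ)
    (u : EuclideanSpace ℝ (Fin m)) (r : ℝ) : ℝ :=
  w * r + inner ℝ g u / 2 * r ^ 2
    + (H u u / 6 - (‖g‖ ^ 2 - inner ℝ g u ^ 2) / (24 * w)) * r ^ 3

section Perp

variable {m : ℕ} {u : EuclideanSpace ℝ (Fin m)}

theorem inner_sub_smul_self (hu : ‖u‖ = 1) (g : EuclideanSpace ℝ (Fin m)) :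
    inner ℝ u (g - inner ℝ g u • u) = 0 := by
  rw [inner_sub_right, real_inner_smul_right, real_inner_self_eq_norm_sq, hu,
    real_inner_comm]
  ring

theorem norm_sub_smul_sq (hu : ‖u‖ = 1) (g : EuclideanSpace ℝ (Fin m)) :
    ‖g - inner ℝ g u • u‖ ^ 2 = ‖g‖ ^ 2 - inner ℝ g u ^ 2 := by
  rw [norm_sub_sq_real, norm_smul, real_inner_smul_right, hu, Real.norm_eq_abs, mul_one, sq_abs]
  ring

theorem norm_sub_smul_le (hu : ‖u‖ = 1) (g : EuclideanSpace ℝ (Fin m)) :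
    ‖g - inner ℝ g u • u‖ ≤ ‖g‖ := by
  refine abs_le_of_sq_le_sq' ?_ (norm_nonneg _) |>.2
  rw [norm_sub_smul_sq hu]
  nlinarith [sq_nonneg (inner ℝ g u)]

end Perp

theorem abs_bilin_le {m : ℕ} {H : EuclideanSpace ℝ (Fin m) →L[ℝ] EuclideanSpace ℝ (Fin m) →L[ℝ] ℝ}
    {N : ℝ} (hH : ‖H‖ ≤ N) (a b : EuclideanSpace ℝ (Fin m)) : |H a b| ≤ N * ‖a‖ * ‖b‖ := by
  refine (H.le_opNorm₂ a b).trans ?_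
  gcongr

/-! ### The upper bound -/

/-- The weight changes by `O(r)` along the test path. -/
theorem abs_weight_increment_le {r t gu κ h N : ℝ} (hr : 0 < r) (hr1 : r ≤ 1)
    (ht : t ∈ Set.Icc (0 : ℝ) 1) (hN : 1 ≤ N) (hgu : |gu| ≤ N) (hκN : |κ| ≤ N ^ 2)
    (hh : |h| ≤ N) :
    |t * r * gu + t * (t - 1) / 2 * r ^ 2 * κ + t ^ 2 * r ^ 2 * h / 2| ≤ 3 * N ^ 2 * r := by
  obtain ⟨ht0, ht1⟩ := ht
  have hr2 : r ^ 2 ≤ r := by nlinarith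
  have hN2 : N ≤ N ^ 2 := by nlinarith
  have h1 : |t * r * gu| ≤ N ^ 2 * r := by
    rw [abs_mul, abs_of_nonneg (by positivity)]
    calc t * r * |gu| ≤ 1 * r * N ^ 2 := by gcongr; exact hgu.trans hN2
      _ = _ := by ring
  have h2 : |t * (t - 1) / 2 * r ^ 2 * κ| ≤ N ^ 2 * r := by
    rw [abs_mul, abs_mul, abs_of_nonneg (sq_nonneg r)]
    have : |t * (t - 1) / 2| ≤ 1 := by rw [abs_le]; constructor <;> nlinarith
    calc |t * (t - 1) / 2| * r ^ 2 * |κ| ≤ 1 * r * N ^ 2 := by gcongr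
      _ = _ := by ring
  have h3 : |t ^ 2 * r ^ 2 * h / 2| ≤ N ^ 2 * r := by
    have : |t ^ 2 * r ^ 2 * h / 2| = t ^ 2 / 2 * r ^ 2 * |h| := by
      rw [abs_div, abs_mul, abs_of_nonneg (by positivity : 0 ≤ t ^ 2 * r ^ 2),
        abs_of_pos (zero_lt_two' ℝ)]
      ring
    rw [this]
    calc t ^ 2 / 2 * r ^ 2 * |h| ≤ 1 * r * N ^ 2 := by
          gcongr
          · nlinarith
          · exact hh.trans hN2
      _ = _ := by ring
  refine (abs_add_three _ _ _).trans (by linarith)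

/-- The integrand of the length of the test path at time `t`, with `W` the weight, `V` the speed,
`gu = ⟪g, u⟫`, `h = H(u, u)`, `G = ‖g⊥‖ / w` and `κ = ‖g⊥‖² / w`: up to `O(r⁴)` it is quadratic
in `t`. -/
theorem test_path_speed_mul_weight_le {r t w₀ gu κ h G W V N : ℝ} (hr : 0 < r) (hr1 : r ≤ 1)
    (ht : t ∈ Set.Icc (0 : ℝ) 1) (hN : 1 ≤ N)
    (hgu : |gu| ≤ N) (hκ : κ = w₀ * G ^ 2) (hκN : |κ| ≤ N ^ 2) (hG : 0 ≤ G) (hGN : G ≤ N)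
    (hh : |h| ≤ N)
    (hW : W ≤ w₀ + t * r * gu + t * (t - 1) / 2 * r ^ 2 * κ + t ^ 2 * r ^ 2 * h / 2
      + 9 * N ^ 4 * r ^ 3)
    (hV0 : 0 ≤ V) (hV : V ^ 2 = r ^ 2 + ((t - 1 / 2) * r ^ 2) ^ 2 * G ^ 2) (hW0 : 0 ≤ W) :
    W * V ≤ (w₀ * r + r ^ 3 * κ / 8 + 21 * N ^ 6 * r ^ 4) + (r ^ 2 * gu - r ^ 3 * κ) * t
      + (r ^ 3 * κ + r ^ 3 * h / 2) * t ^ 2 := by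
  obtain ⟨P, hP⟩ : ∃ P, P = (t - 1 / 2) ^ 2 * r ^ 2 * G ^ 2 / 2 := ⟨_, rfl⟩
  have hP0 : 0 ≤ P := by rw [hP]; positivity
  have htq : (t - 1 / 2) ^ 2 ≤ 1 / 4 := by nlinarith [ht.1, ht.2]
  have hPN : P ≤ N ^ 2 * r ^ 2 := by
    calc P = (t - 1 / 2) ^ 2 * (r ^ 2 * G ^ 2) / 2 := by rw [hP]; ring
      _ ≤ 1 / 4 * (r ^ 2 * N ^ 2) / 2 := by gcongr
      _ ≤ N ^ 2 * r ^ 2 := by nlinarith [mul_nonneg (sq_nonneg N) (sq_nonneg r)]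
  have hVP : V ≤ r * (1 + P) := by
    refine abs_le_of_sq_le_sq' ?_ (by positivity) |>.2
    rw [hV]
    have : ((t - 1 / 2) * r ^ 2) ^ 2 * G ^ 2 = r ^ 2 * (2 * P) := by rw [hP]; ring
    rw [this]
    nlinarith [mul_nonneg (sq_nonneg r) (sq_nonneg P)]
  obtain ⟨e, he⟩ : ∃ e, e = t * r * gu + t * (t - 1) / 2 * r ^ 2 * κ + t ^ 2 * r ^ 2 * h / 2 :=
    ⟨_, rfl⟩
  have hr2 : r ^ 2 ≤ r := by nlinarith
  have heN : |e| ≤ 3 * N ^ 2 * r := by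
    rw [he]; exact abs_weight_increment_le hr hr1 ht hN hgu hκN hh
  have heP : e * P ≤ 3 * N ^ 6 * r ^ 3 := by
    calc e * P ≤ |e| * P := by gcongr; exact le_abs_self e
      _ ≤ (3 * N ^ 2 * r) * (N ^ 2 * r ^ 2) := by gcongr
      _ = 3 * N ^ 4 * r ^ 3 := by ring
      _ ≤ 3 * N ^ 6 * r ^ 3 := by
        have := pow_le_pow_right₀ hN (show 4 ≤ 6 by norm_num)
        gcongr
  have hRP : 9 * N ^ 4 * r ^ 3 * (1 + P) ≤ 18 * N ^ 6 * r ^ 3 := by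
    have h1 : 1 + P ≤ 2 * N ^ 2 := by
      have h2 : N ^ 2 * r ^ 2 ≤ N ^ 2 * 1 := by gcongr; exact hr2.trans hr1
      linarith [one_le_pow₀ hN (n := 2)]
    calc 9 * N ^ 4 * r ^ 3 * (1 + P) ≤ 9 * N ^ 4 * r ^ 3 * (2 * N ^ 2) := by gcongr
      _ = _ := by ring
  have hκP : w₀ * P = (t - 1 / 2) ^ 2 * r ^ 2 * κ / 2 := by rw [hP, hκ]; ring
  calc W * V ≤ (w₀ + e + 9 * N ^ 4 * r ^ 3) * (r * (1 + P)) := by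
        refine mul_le_mul ?_ hVP hV0 ?_
        · rw [he]; linarith
        · refine hW0.trans ?_; rw [he]; linarith
    _ = r * (w₀ + e + w₀ * P + (e * P + 9 * N ^ 4 * r ^ 3 * (1 + P))) := by ring
    _ ≤ r * (w₀ + e + w₀ * P + (3 * N ^ 6 * r ^ 3 + 18 * N ^ 6 * r ^ 3)) := by gcongr
    _ = _ := by rw [hκP, he]; ring

/-- The terms of `H(z, z) / 2` other than the leading one `t² r² H(u, u) / 2`, divided by `r³`, for
`z = t r u + (t (t - 1) / 2) r² G`. -/
theorem bilin_remainder_le {m : ℕ}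
    {H : EuclideanSpace ℝ (Fin m) →L[ℝ] EuclideanSpace ℝ (Fin m) →L[ℝ] ℝ}
    {u G : EuclideanSpace ℝ (Fin m)} {N r t : ℝ} (hH : ‖H‖ ≤ N) (hN : 1 ≤ N) (hGN : ‖G‖ ≤ N)
    (hu : ‖u‖ = 1) (hr : 0 ≤ r) (hr1 : r ≤ 1) (ht : t ∈ Set.Icc (0 : ℝ) 1) :
    t * (t * (t - 1) / 2) * (H u G + H G u) / 2 + (t * (t - 1) / 2) ^ 2 * r * H G G / 2
      ≤ N ^ 4 := by
  obtain ⟨ht0, ht1⟩ := ht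
  have hq : |t * (t - 1) / 2| ≤ 1 := by rw [abs_le]; constructor <;> nlinarith
  have hN2 : N ^ 2 ≤ N ^ 4 := pow_le_pow_right₀ hN (by norm_num)
  have hN3 : N ^ 3 ≤ N ^ 4 := pow_le_pow_right₀ hN (by norm_num)
  have h1 : |H u G| ≤ N ^ 2 := by
    refine (abs_bilin_le hH u G).trans ?_
    rw [hu, mul_one, sq]; gcongr
  have h2 : |H G u| ≤ N ^ 2 := by
    refine (abs_bilin_le hH G u).trans ?_
    rw [hu, mul_one, sq]; gcongr
  have h3 : |H G G| ≤ N ^ 3 := by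
    refine (abs_bilin_le hH G G).trans ?_
    calc N * ‖G‖ * ‖G‖ ≤ N * N * N := by gcongr
      _ = N ^ 3 := by ring
  have hq8 : |t * (t - 1) / 2| ≤ 1 / 8 := by
    rw [abs_le]; constructor <;> nlinarith [sq_nonneg (t - 1 / 2)]
  have hA : t * (t * (t - 1) / 2) * (H u G + H G u) ≤ N ^ 4 := by
    refine (le_abs_self _).trans ?_
    rw [abs_mul, abs_mul, abs_of_nonneg ht0]
    calc t * |t * (t - 1) / 2| * |H u G + H G u| ≤ 1 * (1 / 8) * (N ^ 2 + N ^ 2) := by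
          gcongr
          exact (abs_add_le _ _).trans (add_le_add h1 h2)
      _ ≤ N ^ 4 := by linarith [sq_nonneg N]
  have hB : (t * (t - 1) / 2) ^ 2 * r * H G G ≤ N ^ 4 := by
    refine (le_abs_self _).trans ?_
    rw [abs_mul, abs_of_nonneg (by positivity : 0 ≤ (t * (t - 1) / 2) ^ 2 * r), ← sq_abs]
    calc |t * (t - 1) / 2| ^ 2 * r * |H G G| ≤ 1 ^ 2 * 1 * N ^ 3 := by gcongr
      _ ≤ N ^ 4 := by linarith
  linarith

theorem integral_quadratic (a b c : ℝ) :
    ∫ t in (0 : ℝ)..1, (a + b * t + c * t ^ 2) = a + b / 2 + c / 3 := by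
  rw [intervalIntegral.integral_add, intervalIntegral.integral_add]
  · rw [intervalIntegral.integral_const_mul, intervalIntegral.integral_const_mul]
    simp; ring
  all_goals exact Continuous.intervalIntegrable (by fun_prop) _ _

/-- The upper bound for the weighted distance, together with the existence of a path. The test path
bends away from the segment by `t (t - 1) r² / 2` times `G = g⊥ / w`, which solves the geodesic
equation to leading order. -/
theorem HasCubicTaylorBound.weightedPathDist_le {m : ℕ} {Ω : Set (EuclideanSpace ℝ (Fin m))}
    {w : EuclideanSpace ℝ (Fin m) → ℝ} {x g : EuclideanSpace ℝ (Fin m)}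
    {H : EuclideanSpace ℝ (Fin m) →L[ℝ] EuclideanSpace ℝ (Fin m) →L[ℝ] ℝ} {N ε : ℝ}
    (hT : HasCubicTaylorBound Ω w x g H N ε) (hwc : ContinuousOn w Ω)
    {u : EuclideanSpace ℝ (Fin m)} (hu : ‖u‖ = 1) {r : ℝ} (hr : 0 < r) (hr1 : r ≤ 1)
    (hrε : 2 * N * r ≤ ε) :
    (∃ γ, IsPiecewiseC1Path Ω x (x + r • u) γ) ∧
      weightedPathDist Ω w x (x + r • u) ≤ distExpansion (w x) g H u r + 21 * N ^ 6 * r ^ 4 := by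
  have hN := hT.one_le
  have hw := hT.weight_pos
  have hε : 0 ≤ ε := le_trans (by positivity) hrε
  have hx : x ∈ Ω := by simpa using hT.mem 0 (by simpa using hε)
  have hw0 := hw x hx
  obtain ⟨gp, hgp⟩ : ∃ gp, gp = g - inner ℝ g u • u := ⟨_, rfl⟩
  obtain ⟨G, hG⟩ : ∃ G, G = (w x)⁻¹ • gp := ⟨_, rfl⟩
  have hugp : inner ℝ u gp = 0 := by rw [hgp]; exact inner_sub_smul_self hu g
  have huG : inner ℝ u G = 0 := by rw [hG, real_inner_smul_right, hugp, mul_zero]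
  have hGnorm : ‖G‖ = ‖gp‖ / w x := by
    rw [hG, norm_smul, norm_inv, Real.norm_of_nonneg hw0.le, inv_mul_eq_div]
  have hGN : ‖G‖ ≤ N := by
    rw [hGnorm]
    refine le_trans ?_ hT.grad_div_le
    gcongr
    rw [hgp]; exact norm_sub_smul_le hu g
  have hgG : inner ℝ g G = w x * ‖G‖ ^ 2 := by
    have h1 : g = w x • G + inner ℝ g u • u := by
      rw [hG, smul_smul, mul_inv_cancel₀ hw0.ne', one_smul, hgp]; abel
    calc inner ℝ g G = inner ℝ (w x • G + inner ℝ g u • u) G := by rw [← h1]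
      _ = _ := by
        rw [inner_add_left, real_inner_smul_left, real_inner_smul_left, huG,
          real_inner_self_eq_norm_sq]
        ring
  obtain ⟨γ, hγ⟩ : ∃ γ : ℝ → EuclideanSpace ℝ (Fin m),
    γ = fun t => x + ((t * r) • u + (t * (t - 1) / 2 * r ^ 2) • G) := ⟨_, rfl⟩
  have hdisp : ∀ t ∈ Set.Icc (0 : ℝ) 1,
      ‖(t * r) • u + (t * (t - 1) / 2 * r ^ 2) • G‖ ≤ 2 * N * r := by
    rintro t ⟨ht0, ht1⟩
    have hq : |t * (t - 1) / 2| ≤ 1 := by rw [abs_le]; constructor <;> nlinarith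
    refine (norm_add_le _ _).trans ?_
    rw [norm_smul, norm_smul, hu, Real.norm_eq_abs, Real.norm_eq_abs, abs_of_nonneg (by positivity),
      abs_mul, abs_of_nonneg (sq_nonneg r)]
    calc t * r * 1 + |t * (t - 1) / 2| * r ^ 2 * ‖G‖ ≤ 1 * r * N + 1 * r * N := by
          gcongr
          nlinarith
      _ = 2 * N * r := by ring
  have hsm : ContDiff ℝ 1 γ := by
    rw [hγ]; fun_prop
  have hγ0 : γ 0 = x := by rw [hγ]; simp
  have hγ1 : γ 1 = x + r • u := by rw [hγ]; simp
  have hpath : IsPiecewiseC1Path Ω x (x + r • u) γ := by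
    rw [← hγ1]
    nth_rewrite 1 [← hγ0]
    refine isPiecewiseC1Path_of_contDiff hsm fun t ht => ?_
    rw [hγ]
    exact hT.mem _ ((hdisp t ht).trans hrε)
  have hderiv : ∀ t, deriv γ t = r • u + ((t - 1 / 2) * r ^ 2) • G := by
    intro t
    have h1 : HasDerivAt (fun t : ℝ => t * r) r t := by
      simpa using (hasDerivAt_id t).mul_const r
    have h2 : HasDerivAt (fun t : ℝ => t * (t - 1) / 2 * r ^ 2) ((t - 1 / 2) * r ^ 2) t := by
      have := (((hasDerivAt_id t).mul ((hasDerivAt_id t).sub_const 1)).div_const 2).mul_const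
        (r ^ 2)
      exact this.congr_deriv (by simp only [id]; ring)
    rw [hγ]
    exact (((h1.smul_const u).add (h2.smul_const G)).const_add x).deriv
  refine ⟨⟨γ, hpath⟩, (_root_.weightedPathDist_le (fun z hz => (hw z hz).le) hpath).trans ?_⟩
  have hκ24 : (‖g‖ ^ 2 - inner ℝ g u ^ 2) / (24 * w x) = w x * ‖G‖ ^ 2 / 24 := by
    rw [← norm_sub_smul_sq hu, ← hgp, hGnorm]
    field_simp
  have hpt : ∀ t ∈ Set.Icc (0 : ℝ) 1, w (γ t) * ‖deriv γ t‖ ≤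
      (w x * r + r ^ 3 * (w x * ‖G‖ ^ 2) / 8 + 21 * N ^ 6 * r ^ 4)
        + (r ^ 2 * inner ℝ g u - r ^ 3 * (w x * ‖G‖ ^ 2)) * t
        + (r ^ 3 * (w x * ‖G‖ ^ 2) + r ^ 3 * H u u / 2) * t ^ 2 := by
    intro t ht
    have hd := hdisp t ht
    refine test_path_speed_mul_weight_le hr hr1 ht hN ?_ rfl ?_ (norm_nonneg G) hGN
      ?_ ?_ (norm_nonneg _) ?_ (hw _ (hpath.mapsTo ht)).le
    · refine (abs_real_inner_le_norm g u).trans ?_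
      rw [hu, mul_one]; exact hT.grad_le
    · rw [← hgG]
      refine (abs_real_inner_le_norm g G).trans ?_
      rw [sq]
      exact mul_le_mul hT.grad_le hGN (norm_nonneg _) (by positivity)
    · have := abs_bilin_le hT.hess_le u u
      rwa [hu, mul_one, mul_one] at this
    · have hexp := (abs_le.1 (hT.expansion _ (hd.trans hrε))).2
      have hcube : N * ‖(t * r) • u + (t * (t - 1) / 2 * r ^ 2) • G‖ ^ 3 ≤ 8 * N ^ 4 * r ^ 3 := by
        calc _ ≤ N * (2 * N * r) ^ 3 := by gcongr
          _ = _ := by ring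
      have hrem := bilin_remainder_le hT.hess_le hN hGN hu hr.le hr1 ht
      have hr3 : 0 ≤ r ^ 3 := by positivity
      simp only [inner_add_right, real_inner_smul_right, hgG, map_add, map_smul,
        _root_.add_apply, _root_.smul_apply, smul_eq_mul] at hexp
      rw [hγ]
      have hA := mul_le_mul_of_nonneg_left hrem hr3
      linarith [hexp, hcube, hA]
    · rw [hderiv, norm_add_sq_real, norm_smul, norm_smul, hu, real_inner_smul_left,
        real_inner_smul_right, huG, Real.norm_eq_abs, Real.norm_eq_abs, mul_pow, mul_pow, sq_abs,
        sq_abs]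
      ring
  calc ∫ t in (0 : ℝ)..1, w (γ t) * ‖deriv γ t‖ ≤
      ∫ t in (0 : ℝ)..1, ((w x * r + r ^ 3 * (w x * ‖G‖ ^ 2) / 8 + 21 * N ^ 6 * r ^ 4)
        + (r ^ 2 * inner ℝ g u - r ^ 3 * (w x * ‖G‖ ^ 2)) * t
        + (r ^ 3 * (w x * ‖G‖ ^ 2) + r ^ 3 * H u u / 2) * t ^ 2) := by
        refine intervalIntegral.integral_mono_on zero_le_one (hpath.intervalIntegrable hwc) ?_ hpt
        exact Continuous.intervalIntegrable (by fun_prop) _ _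
    _ = _ := by
      rw [integral_quadratic, distExpansion, hκ24]
      ring

/-! ### The lower bound -/

/-- The eikonal inequality for the calibration: `T - κ σ² / 2` bounds its derivative along `u` and
`|σ| p + 2 N e²` the transversal one. The terms `T κ σ²` and `σ² p²` cancel to leading order because
`w₀ κ = p²`. -/
theorem calibration_sq_add_sq_le {T W w₀ κ σ p N e : ℝ} (hN : 1 ≤ N) (he : 0 ≤ e) (he1 : e ≤ 1)
    (hw₀ : 0 ≤ w₀) (hw₀N : w₀ ≤ N) (hκ : w₀ * κ = p ^ 2) (hκ0 : 0 ≤ κ) (hκN : κ ≤ N ^ 2)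
    (hp : 0 ≤ p) (hpN : p ≤ N) (hσ : |σ| ≤ 2 * e) (hTw₀ : |T - w₀| ≤ 2 * N * e)
    (hTW : |W - T| ≤ N * e ^ 3) :
    (T - κ * σ ^ 2 / 2) ^ 2 + (|σ| * p + 2 * N * e ^ 2) ^ 2 ≤ W ^ 2 + 31 * N ^ 4 * e ^ 3 := by
  have hσ2 : σ ^ 2 ≤ 4 * e ^ 2 := by
    rw [← sq_abs]
    calc |σ| ^ 2 ≤ (2 * e) ^ 2 := by gcongr
      _ = _ := by ring
  have he3 : e ^ 4 ≤ e ^ 3 := pow_le_pow_of_le_one he he1 (by norm_num)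
  have hN2 : N ^ 2 ≤ N ^ 4 := pow_le_pow_right₀ hN (by norm_num)
  have hN3 : N ^ 3 ≤ N ^ 4 := pow_le_pow_right₀ hN (by norm_num)
  have h1 : -((T - w₀) * (κ * σ ^ 2)) ≤ 8 * N ^ 4 * e ^ 3 := by
    calc -((T - w₀) * (κ * σ ^ 2)) ≤ |T - w₀| * (κ * σ ^ 2) := by
          rw [← neg_mul]; gcongr; exact neg_le_abs _
      _ ≤ (2 * N * e) * (N ^ 2 * (4 * e ^ 2)) := by gcongr
      _ = 8 * N ^ 3 * e ^ 3 := by ring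
      _ ≤ 8 * N ^ 4 * e ^ 3 := by gcongr
  have h2 : (κ * σ ^ 2) ^ 2 / 4 ≤ 4 * N ^ 4 * e ^ 3 := by
    calc (κ * σ ^ 2) ^ 2 / 4 ≤ (N ^ 2 * (4 * e ^ 2)) ^ 2 / 4 := by gcongr
      _ = 4 * N ^ 4 * e ^ 4 := by ring
      _ ≤ 4 * N ^ 4 * e ^ 3 := by gcongr
  have h3 : 4 * N * e ^ 2 * (|σ| * p) ≤ 8 * N ^ 4 * e ^ 3 := by
    calc 4 * N * e ^ 2 * (|σ| * p) ≤ 4 * N * e ^ 2 * (2 * e * N) := by gcongr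
      _ = 8 * N ^ 2 * e ^ 3 := by ring
      _ ≤ 8 * N ^ 4 * e ^ 3 := by gcongr
  have h4 : 4 * N ^ 2 * e ^ 4 ≤ 4 * N ^ 4 * e ^ 3 := by gcongr
  have h5 : T ^ 2 - W ^ 2 ≤ 7 * N ^ 4 * e ^ 3 := by
    have hNe : N * e ≤ N := mul_le_of_le_one_right (by linarith) he1
    have hNe3 : N * e ^ 3 ≤ N := mul_le_of_le_one_right (by linarith) (pow_le_one₀ he he1)
    have hsum : |T + W| ≤ 7 * N := by
      rw [abs_le] at hTw₀ hTW ⊢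
      constructor <;> linarith [hTw₀.1, hTw₀.2, hTW.1, hTW.2]
    calc T ^ 2 - W ^ 2 = -((W - T) * (T + W)) := by ring
      _ ≤ |W - T| * |T + W| := by rw [← abs_mul]; exact neg_le_abs _
      _ ≤ (N * e ^ 3) * (7 * N) := by gcongr
      _ = 7 * N ^ 2 * e ^ 3 := by ring
      _ ≤ 7 * N ^ 4 * e ^ 3 := by gcongr
  have hexp : (T - κ * σ ^ 2 / 2) ^ 2 + (|σ| * p + 2 * N * e ^ 2) ^ 2 =
      T ^ 2 + -((T - w₀) * (κ * σ ^ 2)) + (κ * σ ^ 2) ^ 2 / 4 + 4 * N * e ^ 2 * (|σ| * p)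
        + 4 * N ^ 2 * e ^ 4 + (|σ| ^ 2 * p ^ 2 - σ ^ 2 * (w₀ * κ)) := by ring
  rw [hexp, hκ, sq_abs]
  linarith

/-- If `A² + b² ≤ W² + 31 N⁴ e³` and `W ≥ 1 / N`, then `A s + b n ≤ (1 + 16 N⁶ e³) W V` as soon
as `s² + n² = V²`. -/
theorem mul_add_mul_le_of_sq_add_sq {A b W N e s n V : ℝ} (hN : 1 ≤ N) (he : 0 ≤ e)
    (hAb : A ^ 2 + b ^ 2 ≤ W ^ 2 + 31 * N ^ 4 * e ^ 3) (hNW : 1 ≤ N * W) (hV0 : 0 ≤ V)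
    (hV : s ^ 2 + n ^ 2 = V ^ 2) :
    A * s + b * n ≤ (1 + 16 * N ^ 6 * e ^ 3) * W * V := by
  have hW : 0 < W := pos_of_mul_pos_right (zero_lt_one.trans_le hNW) (zero_le_one.trans hN)
  have hN0 : 0 ≤ N := zero_le_one.trans hN
  refine abs_le_of_sq_le_sq' ?_ (by positivity) |>.2
  have h1 : 1 ≤ N ^ 2 * W ^ 2 := by
    rw [← mul_pow]; exact one_le_pow₀ hNW
  have h2 : 31 * N ^ 4 * e ^ 3 ≤ 32 * N ^ 6 * e ^ 3 * W ^ 2 := by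
    calc 31 * N ^ 4 * e ^ 3 ≤ 32 * N ^ 4 * e ^ 3 * 1 := by
          have : 0 ≤ N ^ 4 * e ^ 3 := by positivity
          linarith
      _ ≤ 32 * N ^ 4 * e ^ 3 * (N ^ 2 * W ^ 2) := by gcongr
      _ = _ := by ring
  calc (A * s + b * n) ^ 2 ≤ (A ^ 2 + b ^ 2) * (s ^ 2 + n ^ 2) := by
        linarith [sq_nonneg (A * n - b * s)]
    _ ≤ (W ^ 2 + 32 * N ^ 6 * e ^ 3 * W ^ 2) * V ^ 2 := by
        rw [hV]; exact mul_le_mul_of_nonneg_right (by linarith) (sq_nonneg V)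
    _ ≤ ((1 + 16 * N ^ 6 * e ^ 3) * W * V) ^ 2 := by
        have : 0 ≤ (16 * N ^ 6 * e ^ 3 * W * V) ^ 2 := sq_nonneg _
        linarith

section Calibration

variable {m : ℕ}

/-- The calibrating polynomial for the geodesic from `x` to `x + r u`. With `s = ⟪u, z - x⟫` and
`η = z - x - s u`, it is the integral over `[0, s]` of the Taylor polynomial of the weight along
`x + η + σ u`, corrected so that its gradient is tangent to the geodesic at half way; `κ` stands
for `‖g⊥‖² / w`. The bilinear map `H` is not assumed to be symmetric. -/
noncomputable def calibration (w κ r : ℝ) (x g u : EuclideanSpace ℝ (Fin m))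
    (H : EuclideanSpace ℝ (Fin m) →L[ℝ] EuclideanSpace ℝ (Fin m) →L[ℝ] ℝ)
    (z : EuclideanSpace ℝ (Fin m)) : ℝ :=
  let s : ℝ := inner ℝ u (z - x)
  let η : EuclideanSpace ℝ (Fin m) := (z - x) - s • u
  w * s + s * inner ℝ g η + s ^ 2 * (inner ℝ g u / 2) + s * H η η / 2
    + s ^ 2 * (H η u + H u η) / 4 + s ^ 3 * (H u u / 6) - r / 2 * inner ℝ g η
    - κ / 6 * (s - r / 2) ^ 3

/-- The derivative of the calibration in the direction `v = s' u + η'`. Its coefficient at `s'` is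
the Taylor polynomial of the weight minus `κ (s - r/2)² / 2`. -/
theorem calibration_hasFDerivAt (w κ r : ℝ) (x g u : EuclideanSpace ℝ (Fin m))
    (H : EuclideanSpace ℝ (Fin m) →L[ℝ] EuclideanSpace ℝ (Fin m) →L[ℝ] ℝ)
    (z : EuclideanSpace ℝ (Fin m)) :
    ∃ F' : EuclideanSpace ℝ (Fin m) →L[ℝ] ℝ,
      HasFDerivAt (calibration w κ r x g u H) F' z ∧
      ∀ v (s s' : ℝ) (η η' : EuclideanSpace ℝ (Fin m)), s = inner ℝ u (z - x) →
        η = (z - x) - s • u → s' = inner ℝ u v → η' = v - s' • u →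
        F' v = (w + inner ℝ g (z - x) + H (z - x) (z - x) / 2 - κ * (s - r / 2) ^ 2 / 2) * s'
          + ((s - r / 2) * inner ℝ g η' + s * (H η' η + H η η') / 2
            + s ^ 2 * (H η' u + H u η') / 4) := by
  have hs : HasFDerivAt (fun z => (inner ℝ u (z - x) : ℝ)) (innerSL ℝ u) z := by
    exact ((innerSL ℝ u).hasFDerivAt (x := z - x)).comp z ((hasFDerivAt_id z).sub_const x)
  have hη : HasFDerivAt (fun z => (z - x) - (inner ℝ u (z - x) : ℝ) • u)
      (ContinuousLinearMap.id ℝ _ - (innerSL ℝ u).smulRight u) z :=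
    ((hasFDerivAt_id z).sub_const x).sub (hs.smul_const u)
  have hg := ((innerSL ℝ g).hasFDerivAt (x := (z - x) - (inner ℝ u (z - x) : ℝ) • u)).comp z hη
  have hH := H.hasFDerivAt_of_bilinear hη hη
  have hHu := (H.flip u).hasFDerivAt.comp z hη
  have huH := (H u).hasFDerivAt.comp z hη
  have key := ((((((hs.const_mul w).add (hs.mul hg)).add
    ((hs.pow 2).mul_const (inner ℝ g u / 2))).add ((hs.mul hH).mul_const (1 / 2))).add
    (((hs.pow 2).mul (hHu.add huH)).mul_const (1 / 4))).add
    ((hs.pow 3).mul_const (H u u / 6))).sub (hg.const_mul (r / 2))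
  have key2 := key.sub (((hs.sub_const (r / 2)).pow 3).const_mul (κ / 6))
  refine ⟨_, key2.congr_of_eventuallyEq (Filter.Eventually.of_forall fun z => ?_), ?_⟩
  · simp [calibration]
    ring
  · intro v s s' η η' h1 h2 h3 h4
    have h5 : z - x = η + s • u := by rw [h2]; abel
    clear hs hη hg hH hHu huH key key2
    simp only [_root_.add_apply, _root_.sub_apply, _root_.smul_apply,
      ContinuousLinearMap.precompR_apply, ContinuousLinearMap.precompL_apply,
      ContinuousLinearMap.compL_apply, innerSL_apply_apply, ContinuousLinearMap.comp_apply,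
      ContinuousLinearMap.smulRight_apply, Function.comp_apply, ContinuousLinearMap.id_apply,
      ContinuousLinearMap.flip_apply, smul_eq_mul, Pi.add_apply, ← h3]
    simp only [← h1, ← h2, ← h4]
    rw [h5]
    simp only [inner_add_right, real_inner_smul_right, map_add, map_smul, _root_.add_apply,
      _root_.smul_apply, smul_eq_mul, nsmul_eq_mul]
    ring

/-- The calibration increases from `x` to `x + r u` by exactly the third-order expansion; here
`κ / 24` is `2 (1/2)³ κ / 6`, from the last term of its definition. -/
theorem calibration_sub (w κ r : ℝ) (x g u : EuclideanSpace ℝ (Fin m))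
    (H : EuclideanSpace ℝ (Fin m) →L[ℝ] EuclideanSpace ℝ (Fin m) →L[ℝ] ℝ) (hu : ‖u‖ = 1) :
    calibration w κ r x g u H (x + r • u) - calibration w κ r x g u H x =
      w * r + inner ℝ g u / 2 * r ^ 2 + (H u u / 6 - κ / 24) * r ^ 3 := by
  simp [calibration, real_inner_smul_right, hu]
  ring

end Calibration

theorem abs_inner_le_norm_of_unit {m : ℕ} {u : EuclideanSpace ℝ (Fin m)} (hu : ‖u‖ = 1)
    (v : EuclideanSpace ℝ (Fin m)) : |inner ℝ u v| ≤ ‖v‖ := by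
  simpa [hu] using abs_real_inner_le_norm u v

theorem abs_transversal_terms_le {m : ℕ}
    {H : EuclideanSpace ℝ (Fin m) →L[ℝ] EuclideanSpace ℝ (Fin m) →L[ℝ] ℝ}
    {u η v : EuclideanSpace ℝ (Fin m)} {N s e : ℝ} (hH : ‖H‖ ≤ N) (hu : ‖u‖ = 1)
    (hs : |s| ≤ e) (hη : ‖η‖ ≤ e) :
    s * (H v η + H η v) / 2 + s ^ 2 * (H v u + H u v) / 4 ≤ 2 * N * e ^ 2 * ‖v‖ := by
  have hN : 0 ≤ N := (norm_nonneg H).trans hH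
  have he : 0 ≤ e := (abs_nonneg s).trans hs
  have h1 : |H v η + H η v| ≤ 2 * N * e * ‖v‖ := by
    refine (abs_add_le _ _).trans ?_
    calc |H v η| + |H η v| ≤ N * ‖v‖ * ‖η‖ + N * ‖η‖ * ‖v‖ :=
          add_le_add (abs_bilin_le hH _ _) (abs_bilin_le hH _ _)
      _ ≤ N * ‖v‖ * e + N * e * ‖v‖ := by gcongr
      _ = _ := by ring
  have h2 : |H v u + H u v| ≤ 2 * N * ‖v‖ := by
    refine (abs_add_le _ _).trans ?_
    calc |H v u| + |H u v| ≤ N * ‖v‖ * ‖u‖ + N * ‖u‖ * ‖v‖ :=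
          add_le_add (abs_bilin_le hH _ _) (abs_bilin_le hH _ _)
      _ = _ := by rw [hu]; ring
  have h3 : s * (H v η + H η v) ≤ 2 * N * e ^ 2 * ‖v‖ := by
    refine (le_abs_self _).trans ?_
    rw [abs_mul]
    calc |s| * |H v η + H η v| ≤ e * (2 * N * e * ‖v‖) := by gcongr
      _ = _ := by ring
  have h4 : s ^ 2 * (H v u + H u v) ≤ 2 * N * e ^ 2 * ‖v‖ := by
    refine (le_abs_self _).trans ?_
    rw [abs_mul, abs_pow]
    calc |s| ^ 2 * |H v u + H u v| ≤ e ^ 2 * (2 * N * ‖v‖) := by gcongr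
      _ = _ := by ring
  have h5 : 0 ≤ N * e ^ 2 * ‖v‖ := by positivity
  linarith

section LowerBound

variable {m : ℕ} {Ω : Set (EuclideanSpace ℝ (Fin m))} {w : EuclideanSpace ℝ (Fin m) → ℝ}
  {x g : EuclideanSpace ℝ (Fin m)}
  {H : EuclideanSpace ℝ (Fin m) →L[ℝ] EuclideanSpace ℝ (Fin m) →L[ℝ] ℝ} {N ε : ℝ}

/-- On the ball of radius `e` about `x`, the gradient of the calibrating polynomial exceeds the
weight by a factor of at most `1 + O(e³)`. -/
theorem HasCubicTaylorBound.calibration_fderiv_le (hT : HasCubicTaylorBound Ω w x g H N ε)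
    {u : EuclideanSpace ℝ (Fin m)} (hu : ‖u‖ = 1) {r e κ : ℝ} (hr : 0 ≤ r) (hre : r ≤ e)
    (he1 : e ≤ 1) (heε : e ≤ ε) (hκ : κ = ‖g - inner ℝ g u • u‖ ^ 2 / w x)
    {z : EuclideanSpace ℝ (Fin m)} (hz : ‖z - x‖ ≤ e)
    {F' : EuclideanSpace ℝ (Fin m) →L[ℝ] ℝ}
    (hF' : ∀ v (s s' : ℝ) (η η' : EuclideanSpace ℝ (Fin m)), s = inner ℝ u (z - x) →
        η = (z - x) - s • u → s' = inner ℝ u v → η' = v - s' • u →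
        F' v = (w x + inner ℝ g (z - x) + H (z - x) (z - x) / 2 - κ * (s - r / 2) ^ 2 / 2) * s'
          + ((s - r / 2) * inner ℝ g η' + s * (H η' η + H η η') / 2
            + s ^ 2 * (H η' u + H u η') / 4)) (v : EuclideanSpace ℝ (Fin m)) :
    F' v ≤ (1 + 16 * N ^ 6 * e ^ 3) * w z * ‖v‖ := by
  have hN := hT.one_le
  have he : 0 ≤ e := hr.trans hre
  have hxz : x + (z - x) = z := by abel
  have hzΩ : z ∈ Ω := by rw [← hxz]; exact hT.mem _ (hz.trans heε)
  have hxΩ : x ∈ Ω := by simpa using hT.mem 0 (by simpa using he.trans heε)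
  have hw0 := hT.weight_pos x hxΩ
  obtain ⟨gp, hgp⟩ : ∃ gp, gp = g - inner ℝ g u • u := ⟨_, rfl⟩
  have hgpg : ‖gp‖ ≤ ‖g‖ := by rw [hgp]; exact norm_sub_smul_le hu g
  obtain ⟨s, hs⟩ : ∃ s : ℝ, s = inner ℝ u (z - x) := ⟨_, rfl⟩
  obtain ⟨η, hη⟩ : ∃ η, η = (z - x) - s • u := ⟨_, rfl⟩
  obtain ⟨s', hs'⟩ : ∃ s' : ℝ, s' = inner ℝ u v := ⟨_, rfl⟩
  obtain ⟨η', hη'⟩ : ∃ η', η' = v - s' • u := ⟨_, rfl⟩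
  have hse : |s| ≤ e := by rw [hs]; exact (abs_inner_le_norm_of_unit hu _).trans hz
  have hηe : ‖η‖ ≤ e := by
    rw [hη, hs, real_inner_comm]; exact (norm_sub_smul_le hu _).trans hz
  have hσ : |s - r / 2| ≤ 2 * e := by
    rw [abs_le] at hse ⊢; constructor <;> linarith [hse.1, hse.2]
  -- the transversal component of `v` only sees the transversal component of `g`
  have hgη' : inner ℝ g η' = inner ℝ gp η' := by
    have : inner ℝ u η' = 0 := by
      rw [hη', hs', real_inner_comm v u]; exact inner_sub_smul_self hu v
    rw [hgp, inner_sub_left, real_inner_smul_left, this]; ring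
  have hpyth : s' ^ 2 + ‖η'‖ ^ 2 = ‖v‖ ^ 2 := by
    rw [hη', hs', real_inner_comm v u, norm_sub_smul_sq hu]; ring
  have hκ' : κ = ‖gp‖ ^ 2 / w x := by rw [hκ, hgp]
  have hκN : κ ≤ N ^ 2 := by
    rw [hκ']
    calc ‖gp‖ ^ 2 / w x = ‖gp‖ * (‖gp‖ / w x) := by ring
      _ ≤ ‖g‖ * (‖g‖ / w x) := by gcongr
      _ ≤ N * N := mul_le_mul hT.grad_le hT.grad_div_le (by positivity) (by positivity)
      _ = N ^ 2 := by ring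
  have hTexp := hT.expansion (z - x) (hz.trans heε)
  rw [hxz] at hTexp
  have hlin : |inner ℝ g (z - x)| ≤ N * e := (abs_real_inner_le_norm _ _).trans
    (mul_le_mul hT.grad_le hz (norm_nonneg _) (by positivity))
  have hquad : |H (z - x) (z - x)| ≤ N * e := by
    refine (abs_bilin_le hT.hess_le _ _).trans ?_
    calc N * ‖z - x‖ * ‖z - x‖ ≤ N * e * 1 := by gcongr; exact hz.trans he1
      _ = N * e := mul_one _
  have hAb := calibration_sq_add_sq_le (T := w x + inner ℝ g (z - x) + H (z - x) (z - x) / 2)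
    (W := w z) (w₀ := w x) (κ := κ) (σ := s - r / 2) (p := ‖gp‖) hN he he1 hw0.le hT.weight_le
    (by rw [hκ']; field_simp) (by rw [hκ']; positivity) hκN (norm_nonneg _)
    (hgpg.trans hT.grad_le) hσ
    (by
      rw [abs_le] at hlin hquad ⊢
      have : 0 ≤ N * e := by positivity
      constructor <;> linarith [hlin.1, hlin.2, hquad.1, hquad.2])
    (hTexp.trans (by gcongr))
  refine le_trans ?_ (mul_add_mul_le_of_sq_add_sq (s := s') (n := ‖η'‖) hN he hAb
    (hT.one_le_mul_weight z hzΩ) (norm_nonneg v) hpyth)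
  rw [hF' v s s' η η' hs hη hs' hη', hgη']
  have h1 := abs_transversal_terms_le (v := η') hT.hess_le hu hse hηe
  have h2 : (s - r / 2) * inner ℝ gp η' ≤ |s - r / 2| * ‖gp‖ * ‖η'‖ := by
    refine (le_abs_self _).trans ?_
    rw [abs_mul, mul_assoc]
    gcongr
    exact abs_real_inner_le_norm _ _
  linarith

theorem HasCubicTaylorBound.distExpansion_le_two_mul (hT : HasCubicTaylorBound Ω w x g H N ε)
    (hε : 0 ≤ ε) {u : EuclideanSpace ℝ (Fin m)} (hu : ‖u‖ = 1) {r : ℝ} (hr : 0 ≤ r)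
    (hr1 : r ≤ 1) : distExpansion (w x) g H u r ≤ 2 * N * r := by
  have hN := hT.one_le
  have hw0 := hT.weight_pos x (by simpa using hT.mem 0 (by simpa using hε))
  have hgu : inner ℝ g u ≤ N := by
    refine (real_inner_le_norm g u).trans ?_
    rw [hu, mul_one]; exact hT.grad_le
  have hHu : H u u ≤ N := by
    have := (abs_le.1 (abs_bilin_le hT.hess_le u u)).2
    rwa [hu, mul_one, mul_one] at this
  have hκ : 0 ≤ (‖g‖ ^ 2 - inner ℝ g u ^ 2) / (24 * w x) := by
    rw [← norm_sub_smul_sq hu]; positivity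
  have hr2 : r ^ 2 ≤ r := by nlinarith
  have hr3 : r ^ 3 ≤ r := by
    calc r ^ 3 ≤ r ^ 1 := pow_le_pow_of_le_one hr hr1 (by norm_num)
      _ = r := pow_one r
  rw [distExpansion]
  calc _ ≤ N * r + N / 2 * r ^ 2 + (N / 6 - 0) * r ^ 3 := by
        have := hT.weight_le
        gcongr
    _ ≤ N * r + N / 2 * r + (N / 6 - 0) * r := by
        have : 0 ≤ N / 6 - 0 := by linarith
        gcongr
    _ ≤ 2 * N * r := by
        have : 0 ≤ N * r := by positivity
        linarith

/-- The lower bound for the weighted length: a path that stays within distance `2 N² r` of `x` is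
bounded below by the calibration, and a path that leaves this ball is too long anyway. -/
theorem HasCubicTaylorBound.distExpansion_le (hT : HasCubicTaylorBound Ω w x g H N ε)
    (hwc : ContinuousOn w Ω) {u : EuclideanSpace ℝ (Fin m)} (hu : ‖u‖ = 1) {r : ℝ} (hr : 0 < r)
    (hrε : 2 * N ^ 2 * r ≤ ε) (hr1 : 2 * N ^ 2 * r ≤ 1) {γ : ℝ → EuclideanSpace ℝ (Fin m)}
    (hγ : IsPiecewiseC1Path Ω x (x + r • u) γ) :
    distExpansion (w x) g H u r ≤
      (∫ t in (0 : ℝ)..1, w (γ t) * ‖deriv γ t‖) + 256 * N ^ 13 * r ^ 4 := by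
  have hN := hT.one_le
  have hw := hT.weight_pos
  obtain ⟨e, he⟩ : ∃ e, e = 2 * N ^ 2 * r := ⟨_, rfl⟩
  rw [← he] at hrε hr1
  have he0 : 0 ≤ e := by rw [he]; positivity
  have hre : r ≤ e := by
    rw [he]; nlinarith [one_le_pow₀ hN (n := 2)]
  have hD := hT.distExpansion_le_two_mul (he0.trans hrε) hu hr.le (hre.trans hr1)
  have hℓ0 := weightedLength_nonneg hγ fun z hz => (hw z hz).le
  obtain ⟨ℓ, hℓ⟩ : ∃ ℓ, ℓ = ∫ t in (0 : ℝ)..1, w (γ t) * ‖deriv γ t‖ := ⟨_, rfl⟩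
  obtain ⟨D, hDdef⟩ : ∃ D, D = distExpansion (w x) g H u r := ⟨_, rfl⟩
  rw [← hℓ] at hℓ0 ⊢
  rw [← hDdef] at hD ⊢
  have herr : 0 ≤ 256 * N ^ 13 * r ^ 4 := by positivity
  -- the ball has radius comparable to `r`, large enough that a path leaving it is longer than `D`
  by_cases hball : ∀ t ∈ Set.Icc (0 : ℝ) 1, ‖γ t - x‖ ≤ e
  · obtain ⟨κ, hκ⟩ : ∃ κ, κ = ‖g - inner ℝ g u • u‖ ^ 2 / w x := ⟨_, rfl⟩
    choose F' hF hF' using calibration_hasFDerivAt (w x) κ r x g u H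
    have hcal := hγ.sub_le_integral (w := fun z => (1 + 16 * N ^ 6 * e ^ 3) * w z)
      (continuousOn_const.mul hwc) hF (fun t ht v =>
        hT.calibration_fderiv_le hu hr.le hre hr1 hrε hκ (hball t ht) (hF' (γ t)) v)
      (Set.right_mem_Icc.2 zero_le_one)
    have hDκ : D = w x * r + inner ℝ g u / 2 * r ^ 2 + (H u u / 6 - κ / 24) * r ^ 3 := by
      rw [hDdef, distExpansion, hκ, norm_sub_smul_sq hu, div_div, mul_comm (w x) 24]
    rw [hγ.target, calibration_sub _ _ _ _ _ _ _ hu, ← hDκ] at hcal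
    simp only [mul_assoc (1 + 16 * N ^ 6 * e ^ 3)] at hcal
    rw [intervalIntegral.integral_const_mul, ← hℓ] at hcal
    by_cases hDℓ : D ≤ ℓ
    · linarith
    · have h1 : 16 * N ^ 6 * e ^ 3 * ℓ ≤ 16 * N ^ 6 * e ^ 3 * (2 * N * r) := by
        gcongr; linarith
      have h2 : 16 * N ^ 6 * e ^ 3 * (2 * N * r) = 256 * N ^ 13 * r ^ 4 := by
        rw [he]; ring
      linarith
  · push Not at hball
    obtain ⟨t, ht, hte⟩ := hball
    have hc : 0 ≤ N⁻¹ := by positivity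
    have h1 := hγ.mul_norm_sub_le_integral hwc hc (fun z hz => by
      rw [inv_le_iff_one_le_mul₀' (by positivity)]
      exact hT.one_le_mul_weight z hz) ht
    rw [← hℓ] at h1
    have h2 : N⁻¹ * e ≤ N⁻¹ * ‖γ t - x‖ := by gcongr
    have h3 : N⁻¹ * e = 2 * N * r := by rw [he]; field_simp
    linarith

/-- The expansion of the weighted distance to third order, with an explicit error bound. -/
theorem HasCubicTaylorBound.abs_weightedPathDist_sub_le (hT : HasCubicTaylorBound Ω w x g H N ε)
    (hwc : ContinuousOn w Ω) {u : EuclideanSpace ℝ (Fin m)} (hu : ‖u‖ = 1) {r : ℝ} (hr : 0 < r)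
    (hrε : 2 * N ^ 2 * r ≤ ε) (hr1 : 2 * N ^ 2 * r ≤ 1) :
    |weightedPathDist Ω w x (x + r • u) - distExpansion (w x) g H u r| ≤ 256 * N ^ 13 * r ^ 4 := by
  have hN := hT.one_le
  have h2 : 2 * N * r ≤ 2 * N ^ 2 * r := by gcongr; nlinarith
  obtain ⟨⟨γ, hγ⟩, hupper⟩ := hT.weightedPathDist_le hwc hu hr (by nlinarith) (h2.trans hrε)
  have hlower := le_weightedPathDist (w := w) hγ
    (b := distExpansion (w x) g H u r - 256 * N ^ 13 * r ^ 4)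
    fun γ' hγ' => by linarith [hT.distExpansion_le hwc hu hr hrε hr1 hγ']
  have h3 : 21 * N ^ 6 * r ^ 4 ≤ 256 * N ^ 13 * r ^ 4 := by
    have := pow_le_pow_right₀ hN (show 6 ≤ 13 by norm_num)
    gcongr
    norm_num
  rw [abs_le]
  constructor <;> linarith

end LowerBound

/-! ### Uniform Taylor expansions -/

section Taylor

variable {E F : Type*} [NormedAddCommGroup E] [NormedSpace ℝ E] [NormedAddCommGroup F]
  [NormedSpace ℝ F]

theorem hasDerivAt_line {f : E → F} {x z : E} {t : ℝ} (hf : DifferentiableAt ℝ f (x + t • z)) :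
    HasDerivAt (fun t : ℝ => f (x + t • z)) (fderiv ℝ f (x + t • z) z) t := by
  have h1 : HasDerivAt (fun t : ℝ => x + t • z) z t := by
    simpa using ((hasDerivAt_id t).smul_const z).const_add x
  exact hf.hasFDerivAt.comp_hasDerivAt t h1

theorem norm_smul_le_of_mem {z : E} {ε t : ℝ} (hz : ‖z‖ ≤ ε) (ht : t ∈ Set.Icc (0 : ℝ) 1) :
    ‖t • z‖ ≤ ε := by
  rw [norm_smul, Real.norm_of_nonneg ht.1]
  exact (mul_le_of_le_one_left (norm_nonneg z) ht.2).trans hz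

theorem norm_sub_first_order_le {f : E → F} {x z : E} {B ε : ℝ}
    (hf : ∀ v, ‖v‖ ≤ ε → DifferentiableAt ℝ f (x + v)) (hB : 0 ≤ B)
    (hf' : ∀ v, ‖v‖ ≤ ε → ‖fderiv ℝ f (x + v) - fderiv ℝ f x‖ ≤ B * ‖v‖) (hz : ‖z‖ ≤ ε) :
    ‖f (x + z) - f x - fderiv ℝ f x z‖ ≤ B * ‖z‖ ^ 2 := by
  have hderiv : ∀ t ∈ Set.Icc (0 : ℝ) 1,
      HasDerivWithinAt (fun t : ℝ => f (x + t • z) - t • fderiv ℝ f x z)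
        (fderiv ℝ f (x + t • z) z - fderiv ℝ f x z) (Set.Icc 0 1) t := fun t ht => by
    have h1 := hasDerivAt_line (hf (t • z) (norm_smul_le_of_mem hz ht))
    have h2 : HasDerivAt (fun t : ℝ => t • fderiv ℝ f x z) (fderiv ℝ f x z) t := by
      simpa using (hasDerivAt_id t).smul_const (fderiv ℝ f x z)
    exact (h1.sub h2).hasDerivWithinAt
  have key := norm_image_sub_le_of_norm_deriv_le_segment_01' hderiv (C := B * ‖z‖ ^ 2)
    fun t ht => by
      have ht' := Set.Ico_subset_Icc_self ht
      rw [← _root_.sub_apply]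
      calc _ ≤ ‖fderiv ℝ f (x + t • z) - fderiv ℝ f x‖ * ‖z‖ := ContinuousLinearMap.le_opNorm _ _
        _ ≤ (B * ‖t • z‖) * ‖z‖ := by
          gcongr; exact hf' _ (norm_smul_le_of_mem hz ht')
        _ ≤ (B * ‖z‖) * ‖z‖ := by
          gcongr; exact norm_smul_le_of_mem le_rfl ht'
        _ = B * ‖z‖ ^ 2 := by ring
  convert key using 2
  simp
  abel

/-- Second-order Taylor bound for a function with Lipschitz second derivative, integrated along
segments so that the symmetry of the second derivative is not needed. -/
theorem abs_sub_second_order_le {f : E → ℝ} {x z : E} {B ε : ℝ}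
    (hf : ∀ v, ‖v‖ ≤ ε → DifferentiableAt ℝ f (x + v)) (hB : 0 ≤ B)
    (hf2 : ∀ v, ‖v‖ ≤ ε → DifferentiableAt ℝ (fderiv ℝ f) (x + v))
    (hf2' : ∀ v, ‖v‖ ≤ ε → ‖fderiv ℝ (fderiv ℝ f) (x + v) - fderiv ℝ (fderiv ℝ f) x‖ ≤ B * ‖v‖)
    (hz : ‖z‖ ≤ ε) :
    |f (x + z) - (f x + fderiv ℝ f x z + fderiv ℝ (fderiv ℝ f) x z z / 2)| ≤ B * ‖z‖ ^ 3 := by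
  have hderiv : ∀ t ∈ Set.Icc (0 : ℝ) 1,
      HasDerivWithinAt (fun t : ℝ => f (x + t • z) - t * fderiv ℝ f x z
          - t ^ 2 * (fderiv ℝ (fderiv ℝ f) x z z / 2))
        (fderiv ℝ f (x + t • z) z - fderiv ℝ f x z - t * fderiv ℝ (fderiv ℝ f) x z z)
        (Set.Icc 0 1) t := fun t ht => by
    have h1 := hasDerivAt_line (hf (t • z) (norm_smul_le_of_mem hz ht))
    have h2 := (hasDerivAt_id t).mul_const (fderiv ℝ f x z)
    have h3 := ((hasDerivAt_id t).pow 2).mul_const (fderiv ℝ (fderiv ℝ f) x z z / 2)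
    exact (((h1.sub h2).sub h3).congr_deriv (by simp; ring)).hasDerivWithinAt
  have key := norm_image_sub_le_of_norm_deriv_le_segment_01' hderiv (C := B * ‖z‖ ^ 3)
    fun t ht => by
      have ht' := Set.Ico_subset_Icc_self ht
      have htz := norm_smul_le_of_mem hz ht'
      have h1 : fderiv ℝ f (x + t • z) z - fderiv ℝ f x z - t * fderiv ℝ (fderiv ℝ f) x z z =
          (fderiv ℝ f (x + t • z) - fderiv ℝ f x - fderiv ℝ (fderiv ℝ f) x (t • z)) z := by
        simp
      rw [h1]
      calc _ ≤ ‖fderiv ℝ f (x + t • z) - fderiv ℝ f x - fderiv ℝ (fderiv ℝ f) x (t • z)‖ * ‖z‖ :=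
            ContinuousLinearMap.le_opNorm _ _
        _ ≤ (B * ‖t • z‖ ^ 2) * ‖z‖ := by
          gcongr; exact norm_sub_first_order_le hf2 hB hf2' htz
        _ ≤ (B * ‖z‖ ^ 2) * ‖z‖ := by
          gcongr; exact norm_smul_le_of_mem le_rfl ht'
        _ = B * ‖z‖ ^ 3 := by ring
  rw [← Real.norm_eq_abs]
  simp only [one_smul, zero_smul, add_zero] at key
  refine le_trans (le_of_eq ?_) key
  congr 1
  ring

end Taylor

theorem inner_gradient_eq_fderiv {m : ℕ} (f : EuclideanSpace ℝ (Fin m) → ℝ)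
    (x v : EuclideanSpace ℝ (Fin m)) : inner ℝ (gradient f x) v = fderiv ℝ f x v := by
  rw [gradient, InnerProductSpace.toDual_symm_apply]

theorem norm_gradient_eq {m : ℕ} (f : EuclideanSpace ℝ (Fin m) → ℝ)
    (x : EuclideanSpace ℝ (Fin m)) : ‖gradient f x‖ = ‖fderiv ℝ f x‖ := by
  rw [gradient, LinearIsometryEquiv.norm_map]

-- the third derivative takes values in a triply nested space of continuous linear maps
set_option maxSynthPendingDepth 6 in
theorem exists_hasCubicTaylorBound {m : ℕ} {Ω : Set (EuclideanSpace ℝ (Fin m))}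
    (hΩ : IsOpen Ω) {w : EuclideanSpace ℝ (Fin m) → ℝ} (hw : ContDiffOn ℝ 3 w Ω) {c : ℝ}
    (hc : 0 < c) (hcw : ∀ z ∈ Ω, c ≤ w z) {K : Set (EuclideanSpace ℝ (Fin m))}
    (hK : IsCompact K) (hKΩ : K ⊆ Ω) :
    ∃ N ε : ℝ, 0 < ε ∧ ∀ x ∈ K,
      HasCubicTaylorBound Ω w x (gradient w x) (fderiv ℝ (fderiv ℝ w) x) N ε := by
  obtain ⟨ε, hε, hεΩ⟩ := hK.exists_cthickening_subset_open hΩ hKΩ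
  have hK' : IsCompact (Metric.cthickening ε K) := hK.cthickening
  have hw1 : ContDiffOn ℝ 2 (fderiv ℝ w) Ω := hw.fderiv_of_isOpen hΩ (by norm_num)
  have hw2 : ContDiffOn ℝ 1 (fderiv ℝ (fderiv ℝ w)) Ω := hw1.fderiv_of_isOpen hΩ (by norm_num)
  have hw3 : ContinuousOn (fderiv ℝ (fderiv ℝ (fderiv ℝ w))) Ω :=
    hw2.continuousOn_fderiv_of_isOpen hΩ le_rfl
  obtain ⟨B₀, hB₀⟩ := hK'.exists_bound_of_continuousOn (hw.continuousOn.mono hεΩ)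
  obtain ⟨B₁, hB₁⟩ := hK'.exists_bound_of_continuousOn (hw1.continuousOn.mono hεΩ)
  obtain ⟨B₂, hB₂⟩ := hK'.exists_bound_of_continuousOn (hw2.continuousOn.mono hεΩ)
  obtain ⟨B₃, hB₃⟩ := hK'.exists_bound_of_continuousOn (hw3.mono hεΩ)
  obtain ⟨N, hN⟩ : ∃ N, N = 1 + |B₀| + |B₁| + |B₂| + |B₃| + |B₁| / c + 1 / c := ⟨_, rfl⟩
  have hp0 := abs_nonneg B₀
  have hp1 := abs_nonneg B₁
  have hp2 := abs_nonneg B₂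
  have hp3 := abs_nonneg B₃
  have hp4 : 0 ≤ |B₁| / c := by positivity
  have hp5 : 0 ≤ 1 / c := by positivity
  refine ⟨N, ε, hε, fun x hx => ?_⟩
  have hxK' : x ∈ Metric.cthickening ε K := Metric.self_subset_cthickening K hx
  have hmem : ∀ v : EuclideanSpace ℝ (Fin m), ‖v‖ ≤ ε → x + v ∈ Metric.cthickening ε K :=
    fun v hv => Metric.closedBall_subset_cthickening hx ε (by simpa using hv)
  have hgrad : ‖gradient w x‖ ≤ |B₁| := by
    rw [norm_gradient_eq]; exact (hB₁ x hxK').trans (le_abs_self _)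
  have hN0 : 0 ≤ N := by linarith
  refine ⟨by linarith, ?_, fun z hz => ?_, by linarith, ?_, ?_, fun v hv => hεΩ (hmem v hv), ?_⟩
  · have := hB₀ x hxK'
    rw [Real.norm_eq_abs] at this
    linarith [le_abs_self (w x), le_abs_self B₀]
  · calc 1 = 1 / c * c := by field_simp
      _ ≤ N * w z := by gcongr; linarith; exact hcw z hz
  · calc ‖gradient w x‖ / w x ≤ |B₁| / c := by gcongr; exact hcw x (hKΩ hx)
      _ ≤ N := by linarith
  · exact (hB₂ x hxK').trans (by linarith [le_abs_self B₂])
  · intro z hz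
    have hd : ∀ {G : Type} [NormedAddCommGroup G] [NormedSpace ℝ G]
        {f : EuclideanSpace ℝ (Fin m) → G}, DifferentiableOn ℝ f Ω →
        ∀ v : EuclideanSpace ℝ (Fin m), ‖v‖ ≤ ε → DifferentiableAt ℝ f (x + v) :=
      fun hf v hv => hf.differentiableAt (hΩ.mem_nhds (hεΩ (hmem v hv)))
    rw [inner_gradient_eq_fderiv]
    refine abs_sub_second_order_le (hd (hw.differentiableOn (by norm_num))) hN0
      (hd (hw1.differentiableOn (by norm_num))) (fun v hv => ?_) hz
    have hmv := (convex_closedBall x ε).norm_image_sub_le_of_norm_fderiv_le (𝕜 := ℝ) (C := N)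
      (f := fderiv ℝ (fderiv ℝ w)) (x := x) (y := x + v)
      (fun y hy => by
        have := hd (hw2.differentiableOn (by norm_num)) (y - x)
          (by simpa [dist_eq_norm] using hy)
        rwa [add_sub_cancel] at this)
      (fun y hy => (hB₃ y (Metric.closedBall_subset_cthickening hx ε hy)).trans
        (by linarith [le_abs_self B₃]))
      (Metric.mem_closedBall_self hε.le) (by simpa using hv)
    simpa using hmv

/-! ### Inversion of the expansion -/

/-- Inversion of the series `S = r + A r² + B r³ + O(r⁴)`. -/
theorem abs_sub_inverse_expansion_le {r S A B L : ℝ} (hL : 1 ≤ L) (hr : 0 ≤ r) (hr1 : r ≤ 1)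
    (hA : |A| ≤ L) (hB : |B| ≤ L) (hS : |S - (r + A * r ^ 2 + B * r ^ 3)| ≤ L * r ^ 4) :
    |r - (S - A * S ^ 2 + (2 * A ^ 2 - B) * S ^ 3)| ≤ 203 * L ^ 5 * r ^ 4 := by
  have hr3 : r ^ 4 ≤ r ^ 3 := pow_le_pow_of_le_one hr hr1 (by norm_num)
  have hr2 : r ^ 3 ≤ r ^ 2 := pow_le_pow_of_le_one hr hr1 (by norm_num)
  have hr1' : r ^ 2 ≤ r := by nlinarith
  have hL2 : L ≤ L ^ 2 := by nlinarith
  obtain ⟨δ₂, hδ₂⟩ : ∃ δ₂, δ₂ = S - r - A * r ^ 2 := ⟨_, rfl⟩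
  obtain ⟨δ, hδ⟩ : ∃ δ, δ = S - r := ⟨_, rfl⟩
  have h2 : |δ₂| ≤ 2 * L * r ^ 3 := by
    calc |δ₂| = |(S - (r + A * r ^ 2 + B * r ^ 3)) + B * r ^ 3| := by rw [hδ₂]; congr 1; ring
      _ ≤ |S - (r + A * r ^ 2 + B * r ^ 3)| + |B * r ^ 3| := abs_add_le _ _
      _ = |S - (r + A * r ^ 2 + B * r ^ 3)| + |B| * r ^ 3 := by
        rw [abs_mul, abs_of_nonneg (by positivity : 0 ≤ r ^ 3)]
      _ ≤ L * r ^ 3 + L * r ^ 3 := by gcongr; exact hS.trans (by gcongr)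
      _ = _ := by ring
  have h1 : |δ| ≤ 3 * L * r ^ 2 := by
    calc |δ| = |δ₂ + A * r ^ 2| := by rw [hδ, hδ₂]; congr 1; ring
      _ ≤ |δ₂| + |A * r ^ 2| := abs_add_le _ _
      _ = |δ₂| + |A| * r ^ 2 := by rw [abs_mul, abs_of_nonneg (by positivity : 0 ≤ r ^ 2)]
      _ ≤ 2 * L * r ^ 2 + L * r ^ 2 := by gcongr; exact h2.trans (by gcongr)
      _ = _ := by ring
  have h0 : |S| ≤ 4 * L * r := by
    calc |S| = |δ + r| := by rw [hδ]; congr 1; ring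
      _ ≤ |δ| + |r| := abs_add_le _ _
      _ = |δ| + 1 * r := by rw [abs_of_nonneg hr, one_mul]
      _ ≤ 3 * L * r + L * r := by gcongr; exact h1.trans (by gcongr)
      _ = _ := by ring
  have hsq : |S ^ 2 - r ^ 2 - 2 * A * r ^ 3| ≤ 13 * L ^ 2 * r ^ 4 := by
    calc |S ^ 2 - r ^ 2 - 2 * A * r ^ 3| = |δ ^ 2 + 2 * r * δ₂| := by
          rw [hδ, hδ₂]; congr 1; ring
      _ ≤ |δ ^ 2| + |2 * r * δ₂| := abs_add_le _ _
      _ = |δ| ^ 2 + 2 * r * |δ₂| := by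
        rw [abs_pow, abs_mul, abs_of_nonneg (by positivity : 0 ≤ 2 * r)]
      _ ≤ (3 * L * r ^ 2) ^ 2 + 2 * r * (2 * L * r ^ 3) := by gcongr
      _ = 9 * L ^ 2 * r ^ 4 + 4 * L * r ^ 4 := by ring
      _ ≤ 9 * L ^ 2 * r ^ 4 + 4 * L ^ 2 * r ^ 4 := by gcongr
      _ = _ := by ring
  have hcube : |S ^ 3 - r ^ 3| ≤ 63 * L ^ 3 * r ^ 4 := by
    have h3 : |S ^ 2 + S * r + r ^ 2| ≤ 21 * L ^ 2 * r ^ 2 := by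
      calc |S ^ 2 + S * r + r ^ 2| ≤ |S ^ 2| + |S * r| + |r ^ 2| := abs_add_three _ _ _
        _ = |S| ^ 2 + |S| * r + 1 * r ^ 2 := by
          rw [abs_pow, abs_mul, abs_pow, abs_of_nonneg hr, one_mul]
        _ ≤ (4 * L * r) ^ 2 + 4 * L * r * r + L ^ 2 * r ^ 2 := by
          gcongr; exact one_le_pow₀ hL
        _ = 17 * L ^ 2 * r ^ 2 + 4 * L * r ^ 2 := by ring
        _ ≤ 17 * L ^ 2 * r ^ 2 + 4 * L ^ 2 * r ^ 2 := by gcongr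
        _ = _ := by ring
    calc |S ^ 3 - r ^ 3| = |δ| * |S ^ 2 + S * r + r ^ 2| := by
          rw [hδ, ← abs_mul]; congr 1; ring
      _ ≤ (3 * L * r ^ 2) * (21 * L ^ 2 * r ^ 2) := by gcongr
      _ = _ := by ring
  have hAB : |2 * A ^ 2 - B| ≤ 3 * L ^ 2 := by
    calc |2 * A ^ 2 - B| ≤ |2 * A ^ 2| + |B| := abs_sub _ _
      _ = 2 * |A| ^ 2 + |B| := by rw [abs_mul, abs_pow, abs_of_pos (zero_lt_two' ℝ)]
      _ ≤ 2 * L ^ 2 + L ^ 2 := by gcongr; exact hB.trans hL2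
      _ = _ := by ring
  have hL15 : L ≤ L ^ 5 := by
    calc L = L ^ 1 := (pow_one L).symm
      _ ≤ L ^ 5 := pow_le_pow_right₀ hL (by norm_num)
  have hL35 : L ^ 3 ≤ L ^ 5 := pow_le_pow_right₀ hL (by norm_num)
  calc |r - (S - A * S ^ 2 + (2 * A ^ 2 - B) * S ^ 3)|
      = |-(S - (r + A * r ^ 2 + B * r ^ 3)) + A * (S ^ 2 - r ^ 2 - 2 * A * r ^ 3)
          + -((2 * A ^ 2 - B) * (S ^ 3 - r ^ 3))| := by congr 1; ring
    _ ≤ |S - (r + A * r ^ 2 + B * r ^ 3)| + |A| * |S ^ 2 - r ^ 2 - 2 * A * r ^ 3|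
          + |2 * A ^ 2 - B| * |S ^ 3 - r ^ 3| := by
        refine (abs_add_three _ _ _).trans_eq ?_
        rw [abs_neg, abs_neg, abs_mul, abs_mul]
    _ ≤ L * r ^ 4 + L * (13 * L ^ 2 * r ^ 4) + 3 * L ^ 2 * (63 * L ^ 3 * r ^ 4) := by gcongr
    _ = L * r ^ 4 + 13 * L ^ 3 * r ^ 4 + 189 * L ^ 5 * r ^ 4 := by ring
    _ ≤ L ^ 5 * r ^ 4 + 13 * L ^ 5 * r ^ 4 + 189 * L ^ 5 * r ^ 4 := by gcongr
    _ = _ := by ring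

theorem le_two_mul_of_expansion {r S A B L : ℝ} (hr : 0 ≤ r) (hr1 : 6 * L * r ≤ 1)
    (hL : 1 ≤ L) (hA : |A| ≤ L) (hB : |B| ≤ L)
    (hS : |S - (r + A * r ^ 2 + B * r ^ 3)| ≤ L * r ^ 4) : r ≤ 2 * S := by
  have hr' : r ≤ 1 := by nlinarith
  have hr3 : r ^ 4 ≤ r ^ 2 := pow_le_pow_of_le_one hr hr' (by norm_num)
  have hr2 : r ^ 3 ≤ r ^ 2 := pow_le_pow_of_le_one hr hr' (by norm_num)
  have h1 : -(L * r ^ 2) ≤ A * r ^ 2 := by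
    rw [← neg_mul]; gcongr; exact (abs_le.1 hA).1
  have h2 : -(L * r ^ 2) ≤ B * r ^ 3 := by
    have : -L * r ^ 3 ≤ B * r ^ 3 := by gcongr; exact (abs_le.1 hB).1
    have : L * r ^ 3 ≤ L * r ^ 2 := by gcongr
    linarith
  have h3 : L * r ^ 4 ≤ L * r ^ 2 := by gcongr
  have h4 : 6 * (L * r ^ 2) ≤ r := by
    calc 6 * (L * r ^ 2) = (6 * L * r) * r := by ring
      _ ≤ 1 * r := by gcongr
      _ = r := one_mul r
  linarith [(abs_le.1 hS).1]

section WeightedInversion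

variable {m : ℕ} {Ω : Set (EuclideanSpace ℝ (Fin m))} {w : EuclideanSpace ℝ (Fin m) → ℝ}
  {x g : EuclideanSpace ℝ (Fin m)}
  {H : EuclideanSpace ℝ (Fin m) →L[ℝ] EuclideanSpace ℝ (Fin m) →L[ℝ] ℝ} {N ε : ℝ}

/-- The two expansions for a general weight: of the Euclidean distance `r` in terms of the weighted
distance `D`, and conversely. Here `D / w` equals `r + A r² + B r³` up to `O(r⁴)`. -/
theorem HasCubicTaylorBound.expansions (hT : HasCubicTaylorBound Ω w x g H N ε)
    (hwc : ContinuousOn w Ω) {u : EuclideanSpace ℝ (Fin m)} (hu : ‖u‖ = 1) {r : ℝ} (hr : 0 < r)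
    (hrε : 2 * N ^ 2 * r ≤ ε) (hr1 : 6 * (256 * N ^ 14) * r ≤ 1) {A B D : ℝ}
    (hA : A = inner ℝ g u / (2 * w x))
    (hB : B = (H u u / 6 - (‖g‖ ^ 2 - inner ℝ g u ^ 2) / (24 * w x)) / w x)
    (hD : D = weightedPathDist Ω w x (x + r • u)) :
    |r - (D / w x - A * (D / w x) ^ 2 + (2 * A ^ 2 - B) * (D / w x) ^ 3)|
        ≤ 203 * (256 * N ^ 14) ^ 5 * (16 * N ^ 4) * D ^ 4 ∧
      |D - w x * (r + A * r ^ 2)| ≤ 512 * N ^ 15 * r ^ 3 := by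
  have hN := hT.one_le
  obtain ⟨L, hL⟩ : ∃ L, L = 256 * N ^ 14 := ⟨_, rfl⟩
  have hNL : ∀ k ≤ 14, 256 * N ^ k ≤ L := fun k hk => by
    rw [hL]; gcongr
  have hL1 : 1 ≤ L := by
    have := hNL 0 (by norm_num)
    linarith
  have hε : 0 ≤ ε := le_trans (by positivity) hrε
  have hx : x ∈ Ω := by simpa using hT.mem 0 (by simpa using hε)
  have hw0 := hT.weight_pos x hx
  have hwinv : (w x)⁻¹ ≤ N := by
    rw [inv_le_iff_one_le_mul₀ hw0]; exact hT.one_le_mul_weight x hx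
  have hr1' : 2 * N ^ 2 * r ≤ 1 := by
    refine le_trans ?_ hr1
    have := hNL 2 (by norm_num)
    rw [← hL]; gcongr
    · norm_num
    · linarith [sq_nonneg N]
  have hrle1 : r ≤ 1 := by
    refine le_trans ?_ hr1
    rw [← hL]; nlinarith
  have hmain := hT.abs_weightedPathDist_sub_le hwc hu hr hrε hr1'
  rw [← hD] at hmain
  have hgu : |inner ℝ g u| ≤ N := by
    refine (abs_real_inner_le_norm g u).trans ?_
    rw [hu, mul_one]; exact hT.grad_le
  have hAL : |A| ≤ L := by
    rw [hA, abs_div, abs_of_pos (by positivity : 0 < 2 * w x)]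
    calc |inner ℝ g u| / (2 * w x) = |inner ℝ g u| * (w x)⁻¹ / 2 := by
          field_simp
      _ ≤ N * N / 2 := by gcongr
      _ ≤ 256 * N ^ 2 := by nlinarith [sq_nonneg N]
      _ ≤ L := hNL 2 (by norm_num)
  have hBL : |B| ≤ N ^ 3 := by
    have hH : |H u u| ≤ N := by simpa [hu] using abs_bilin_le hT.hess_le u u
    have h1 : |(‖g‖ ^ 2 - inner ℝ g u ^ 2) / (24 * w x)| ≤ N ^ 2 / 24 := by
      have h2 : 0 ≤ ‖g‖ ^ 2 - inner ℝ g u ^ 2 := by rw [← norm_sub_smul_sq hu]; positivity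
      rw [abs_of_nonneg (by positivity)]
      calc (‖g‖ ^ 2 - inner ℝ g u ^ 2) / (24 * w x) ≤ ‖g‖ ^ 2 / (24 * w x) := by
            gcongr; linarith [sq_nonneg (inner ℝ g u)]
        _ = ‖g‖ * (‖g‖ / w x) / 24 := by field_simp
        _ ≤ N * N / 24 := by
          gcongr
          · exact hT.grad_le
          · exact hT.grad_div_le
        _ = N ^ 2 / 24 := by ring
    rw [hB, div_eq_mul_inv, abs_mul, abs_of_pos (inv_pos.2 hw0)]
    calc |H u u / 6 - (‖g‖ ^ 2 - inner ℝ g u ^ 2) / (24 * w x)| * (w x)⁻¹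
        ≤ (|H u u / 6| + |(‖g‖ ^ 2 - inner ℝ g u ^ 2) / (24 * w x)|) * N := by
          gcongr; exact abs_sub _ _
      _ ≤ (N / 6 + N ^ 2 / 24) * N := by
          gcongr
          rw [abs_div, abs_of_pos (by norm_num : (0 : ℝ) < 6)]
          gcongr
      _ ≤ N ^ 2 * N := by gcongr; nlinarith
      _ = N ^ 3 := by ring
  have hexp : distExpansion (w x) g H u r = w x * (r + A * r ^ 2 + B * r ^ 3) := by
    rw [distExpansion, hA, hB]; field_simp
  rw [hexp] at hmain
  have hS : |D / w x - (r + A * r ^ 2 + B * r ^ 3)| ≤ L * r ^ 4 := by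
    have h1 : D / w x - (r + A * r ^ 2 + B * r ^ 3) =
        (D - w x * (r + A * r ^ 2 + B * r ^ 3)) * (w x)⁻¹ := by field_simp
    rw [h1, abs_mul, abs_of_pos (inv_pos.2 hw0), hL]
    calc _ ≤ 256 * N ^ 13 * r ^ 4 * N := by gcongr
      _ = _ := by ring
  have hBL' : |B| ≤ L := hBL.trans ((le_mul_of_one_le_left (by positivity) (by norm_num)).trans
    (hNL 3 (by norm_num)))
  have hr2S := le_two_mul_of_expansion hr.le (by rwa [← hL] at hr1) hL1 hAL hBL' hS
  constructor
  · refine (abs_sub_inverse_expansion_le hL1 hr.le hrle1 hAL hBL' hS).trans ?_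
    rw [← hL]
    have hDpos : 0 ≤ D / w x := by linarith
    have hD0 : 0 ≤ D := by
      have := mul_nonneg hDpos hw0.le
      rwa [div_mul_cancel₀ _ hw0.ne'] at this
    calc 203 * L ^ 5 * r ^ 4 ≤ 203 * L ^ 5 * (2 * (D * N)) ^ 4 := by
          gcongr
          refine hr2S.trans ?_
          rw [div_eq_mul_inv]; gcongr
      _ = _ := by ring
  · have hr4 : r ^ 4 ≤ r ^ 3 := pow_le_pow_of_le_one hr.le hrle1 (by norm_num)
    calc |D - w x * (r + A * r ^ 2)|
        = |(D - w x * (r + A * r ^ 2 + B * r ^ 3)) + w x * B * r ^ 3| := by congr 1; ring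
      _ ≤ |D - w x * (r + A * r ^ 2 + B * r ^ 3)| + |w x * B * r ^ 3| := abs_add_le _ _
      _ = |D - w x * (r + A * r ^ 2 + B * r ^ 3)| + w x * |B| * r ^ 3 := by
        rw [abs_mul, abs_mul, abs_of_pos hw0, abs_of_pos (by positivity : 0 < r ^ 3)]
      _ ≤ 256 * N ^ 13 * r ^ 3 + N * N ^ 3 * r ^ 3 := by
        gcongr
        · exact hmain.trans (by gcongr)
        · exact hT.weight_le
      _ = (256 * N ^ 13 + N ^ 4) * r ^ 3 := by ring
      _ ≤ (256 * N ^ 15 + 256 * N ^ 15) * r ^ 3 := by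
        have h1 : N ^ 13 ≤ N ^ 15 := pow_le_pow_right₀ hN (by norm_num)
        have h2 : N ^ 4 ≤ N ^ 15 := pow_le_pow_right₀ hN (by norm_num)
        have h3 : 0 ≤ N ^ 15 := by positivity
        gcongr
        linarith
      _ = _ := by ring

end WeightedInversion

/-! ### The weight `ρ ^ (-a)` -/

section PowerWeight

variable {m : ℕ} {ρ : EuclideanSpace ℝ (Fin m) → ℝ} {Ω : Set (EuclideanSpace ℝ (Fin m))} {a : ℝ}

theorem fderiv_one_div_rpow (hΩ : IsOpen Ω) (hpos : ∀ z ∈ Ω, 0 < ρ z)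
    (hρ : DifferentiableOn ℝ ρ Ω) {z : EuclideanSpace ℝ (Fin m)} (hz : z ∈ Ω) :
    fderiv ℝ (fun z => 1 / ρ z ^ a) z = (-a * ρ z ^ (-a - 1)) • fderiv ℝ ρ z := by
  have h1 := ((hρ.differentiableAt (hΩ.mem_nhds hz)).hasFDerivAt).rpow_const (p := -a)
    (Or.inl (hpos z hz).ne')
  refine (h1.congr_of_eventuallyEq ?_).fderiv
  filter_upwards [hΩ.mem_nhds hz] with y hy
  rw [Real.rpow_neg (hpos y hy).le, one_div]

theorem gradient_one_div_rpow (hΩ : IsOpen Ω) (hpos : ∀ z ∈ Ω, 0 < ρ z)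
    (hρ : DifferentiableOn ℝ ρ Ω) {z : EuclideanSpace ℝ (Fin m)} (hz : z ∈ Ω) :
    gradient (fun z => 1 / ρ z ^ a) z = (-a * ρ z ^ (-a - 1)) • gradient ρ z := by
  rw [gradient, fderiv_one_div_rpow hΩ hpos hρ hz, gradient, map_smul]

theorem fderiv_fderiv_one_div_rpow (hΩ : IsOpen Ω) (hpos : ∀ z ∈ Ω, 0 < ρ z)
    (hρ : ContDiffOn ℝ 2 ρ Ω) {x : EuclideanSpace ℝ (Fin m)} (hx : x ∈ Ω)
    (u : EuclideanSpace ℝ (Fin m)) :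
    fderiv ℝ (fderiv ℝ (fun z => 1 / ρ z ^ a)) x u u =
      -a * ρ x ^ (-a - 1) * fderiv ℝ (fderiv ℝ ρ) x u u
        + a * (a + 1) * ρ x ^ (-a - 2) * (fderiv ℝ ρ x u) ^ 2 := by
  have hd : DifferentiableOn ℝ ρ Ω := hρ.differentiableOn (by norm_num)
  have hd2 : DifferentiableAt ℝ (fderiv ℝ ρ) x :=
    ((hρ.fderiv_of_isOpen hΩ (m := 1) (by norm_num)).differentiableOn one_ne_zero).differentiableAt
      (hΩ.mem_nhds hx)
  have h1 := (((hd.differentiableAt (hΩ.mem_nhds hx)).hasFDerivAt).rpow_const (p := -a - 1)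
    (Or.inl (hpos x hx).ne')).const_mul (-a)
  have h2 := h1.smul hd2.hasFDerivAt
  have h3 : fderiv ℝ (fun z => 1 / ρ z ^ a) =ᶠ[nhds x]
      fun z => (-a * ρ z ^ (-a - 1)) • fderiv ℝ ρ z := by
    filter_upwards [hΩ.mem_nhds hx] with y hy
    exact fderiv_one_div_rpow hΩ hpos hd hy
  rw [h3.fderiv_eq]
  erw [h2.fderiv]
  have h4 : -a - 1 - 1 = -a - 2 := by ring
  simp [h4]
  ring

/-- The Hessian, defined as the derivative of the gradient, represents the second derivative. -/
theorem inner_hessian_eq (x u v : EuclideanSpace ℝ (Fin m))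
    (hd : DifferentiableAt ℝ (fderiv ℝ ρ) x) :
    inner ℝ (hessian ρ x u) v = fderiv ℝ (fderiv ℝ ρ) x u v := by
  -- over `ℝ` the conjugate-linear Riesz isomorphism is linear
  let T : (EuclideanSpace ℝ (Fin m) →L[ℝ] ℝ) →ₗ[ℝ] EuclideanSpace ℝ (Fin m) :=
    { toFun := fun f => (InnerProductSpace.toDual ℝ (EuclideanSpace ℝ (Fin m))).symm f
      map_add' := fun f f' => map_add _ f f'
      map_smul' := fun c f => by simp }
  have h1 : HasFDerivAt (gradient ρ) (T.toContinuousLinearMap ∘L fderiv ℝ (fderiv ℝ ρ) x) x :=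
    T.toContinuousLinearMap.hasFDerivAt.comp x hd.hasFDerivAt
  rw [hessian, h1.fderiv]
  exact InnerProductSpace.toDual_symm_apply

end PowerWeight

theorem IsRegularDensity.pos {m : ℕ} {Ω : Set (EuclideanSpace ℝ (Fin m))}
    {ρ : EuclideanSpace ℝ (Fin m) → ℝ} (hρ : IsRegularDensity Ω ρ) : ∀ z ∈ Ω, 0 < ρ z := by
  obtain ⟨β, hβ, hb⟩ := hρ.bounded
  exact fun z hz => (one_div_pos.2 hβ).trans_le (hb z hz).1

theorem IsRegularDensity.exists_weight_lower_bound {m : ℕ} {Ω : Set (EuclideanSpace ℝ (Fin m))}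
    {ρ : EuclideanSpace ℝ (Fin m) → ℝ} (hρ : IsRegularDensity Ω ρ) {a : ℝ} (ha : 0 ≤ a) :
    ∃ c : ℝ, 0 < c ∧ ∀ z ∈ Ω, c ≤ 1 / ρ z ^ a := by
  obtain ⟨β, hβ, hb⟩ := hρ.bounded
  refine ⟨1 / β ^ a, by positivity, fun z hz => ?_⟩
  have := hρ.pos z hz
  gcongr
  exact (hb z hz).2

/-! ### The Fermat distance -/

theorem fermatDist_rpow_mul {m : ℕ} {Ω : Set (EuclideanSpace ℝ (Fin m))}
    {ρ : EuclideanSpace ℝ (Fin m) → ℝ} {p : ℝ} (hp : p ≠ 0) {x y : EuclideanSpace ℝ (Fin m)}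
    (hD : 0 ≤ weightedPathDist Ω (fun z => 1 / ρ z ^ ((p - 1) / (m : ℝ))) x y) (k : ℕ) :
    fermatDist Ω ρ p x y ^ ((k : ℝ) * p) =
      weightedPathDist Ω (fun z => 1 / ρ z ^ ((p - 1) / (m : ℝ))) x y ^ k := by
  rw [fermatDist, ← Real.rpow_mul hD, ← Real.rpow_natCast]
  congr 1
  field_simp

theorem theorem4p2 (m : ℕ) (hm : 1 ≤ m) (p : ℝ) (hp : 1 ≤ p)
    (Ω : Set (EuclideanSpace ℝ (Fin m))) (hΩ_open : IsOpen Ω) (hΩ_conn : IsConnected Ω)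
    (ρ : EuclideanSpace ℝ (Fin m) → ℝ) (hρ : IsRegularDensity Ω ρ)
    (K : Set (EuclideanSpace ℝ (Fin m))) (hK : IsCompact K) (hKΩ : K ⊆ Ω) :
    ∃ M δ : ℝ, 0 < M ∧ 0 < δ ∧
      ∀ x ∈ K, ∀ y ∈ Ω, x ≠ y → ‖y - x‖ < δ →
        ∀ u : EuclideanSpace ℝ (Fin m), u = (1 / ‖y - x‖) • (y - x) →
          |‖y - x‖ -
              (ρ x ^ ((p - 1) / (m : ℝ)) * fermatDist Ω ρ p x y ^ p
                + 1 / 2 * ((p - 1) / (m : ℝ)) * inner ℝ u (gradient ρ x)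
                    * ρ x ^ (2 * (p - 1) / (m : ℝ) - 1) * fermatDist Ω ρ p x y ^ (2 * p)
                + cubicCoeff ρ (2 * (p - 1) / (m : ℝ)) x u * fermatDist Ω ρ p x y ^ (3 * p))|
            ≤ M * fermatDist Ω ρ p x y ^ (4 * p) ∧
          |fermatDist Ω ρ p x y ^ p -
              1 / ρ x ^ ((p - 1) / (m : ℝ)) *
                (‖y - x‖ - 1 / 2 * ((p - 1) / (m : ℝ))
                    * inner ℝ u ((1 / ρ x) • gradient ρ x) * ‖y - x‖ ^ 2)|
            ≤ M * ‖y - x‖ ^ 3 := by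
  have hpos := hρ.pos
  have ha : 0 ≤ (p - 1) / (m : ℝ) := div_nonneg (by linarith) (Nat.cast_nonneg m)
  obtain ⟨c, hc, hcw⟩ := hρ.exists_weight_lower_bound ha
  have hρ3 : ContDiffOn ℝ 3 ρ Ω := hρ.smooth.of_le (WithTop.coe_le_coe.2 le_top)
  have hw : ContDiffOn ℝ 3 (fun z => 1 / ρ z ^ ((p - 1) / (m : ℝ))) Ω :=
    contDiffOn_const.div (hρ3.rpow_const_of_ne fun z hz => (hpos z hz).ne')
      fun z hz => (Real.rpow_pos_of_pos (hpos z hz) _).ne'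
  obtain ⟨N, ε, hε, hT⟩ := exists_hasCubicTaylorBound hΩ_open hw hc hcw hK hKΩ
  obtain ⟨M, hM⟩ : ∃ M, M = 1 + |203 * (256 * N ^ 14) ^ 5 * (16 * N ^ 4)| + |512 * N ^ 15| :=
    ⟨_, rfl⟩
  have hδ1 : 0 < 2 * N ^ 2 + 1 := by positivity
  have hδ2 : 0 < 6 * (256 * N ^ 14) + 1 := by positivity
  refine ⟨M, min (ε / (2 * N ^ 2 + 1)) (1 / (6 * (256 * N ^ 14) + 1)), by rw [hM]; positivity,
    by positivity, fun x hx y hy hxy hyx u hu => ?_⟩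
  obtain ⟨r, hr⟩ : ∃ r, r = ‖y - x‖ := ⟨_, rfl⟩
  rw [← hr] at hyx hu ⊢
  have hr0 : 0 < r := by rw [hr]; exact norm_pos_iff.2 (sub_ne_zero.2 hxy.symm)
  have hu1 : ‖u‖ = 1 := by
    rw [hu, norm_smul, ← hr, Real.norm_of_nonneg (by positivity)]; field_simp
  have hyu : y = x + r • u := by
    rw [hu, smul_smul, mul_one_div_cancel hr0.ne', one_smul]; abel
  have hr1 := (lt_div_iff₀ hδ1).1 (hyx.trans_le (min_le_left _ _))
  have hr2 := (lt_div_iff₀ hδ2).1 (hyx.trans_le (min_le_right _ _))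
  have hxΩ := hKΩ hx
  have hρx := hpos x hxΩ
  have hD0 : 0 ≤ weightedPathDist Ω (fun z => 1 / ρ z ^ ((p - 1) / (m : ℝ))) x y :=
    weightedPathDist_nonneg fun z hz => hc.le.trans (hcw z hz)
  have hp0 : p ≠ 0 := by linarith
  have hf := fermatDist_rpow_mul hp0 hD0
  have hf1 := hf 1
  have hf2 := hf 2
  have hf3 := hf 3
  have hf4 := hf 4
  norm_num only [Nat.cast_one, Nat.cast_ofNat, one_mul, pow_one] at hf1 hf2 hf3 hf4
  rw [hf1, hf2, hf3, hf4]
  obtain ⟨h1, h2⟩ := (hT x hx).expansions hw.continuousOn hu1 hr0 (by linarith) (by linarith)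
    rfl rfl (congrArg _ hyu)
  obtain ⟨D, hD⟩ :
      ∃ D, D = weightedPathDist Ω (fun z => 1 / ρ z ^ ((p - 1) / (m : ℝ))) x y := ⟨_, rfl⟩
  rw [← hD] at h1 h2 hD0 ⊢
  have hd : DifferentiableOn ℝ ρ Ω := hρ3.differentiableOn (by norm_num)
  have hd2 : DifferentiableAt ℝ (fderiv ℝ ρ) x :=
    ((hρ3.fderiv_of_isOpen hΩ_open (m := 2) (by norm_num)).differentiableOn
      two_ne_zero).differentiableAt (hΩ_open.mem_nhds hxΩ)
  rw [gradient_one_div_rpow hΩ_open hpos hd hxΩ,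
    fderiv_fderiv_one_div_rpow hΩ_open hpos (hρ3.of_le (by norm_num)) hxΩ] at h1
  rw [gradient_one_div_rpow hΩ_open hpos hd hxΩ] at h2
  have hα : 2 * (p - 1) / (m : ℝ) = 2 * ((p - 1) / (m : ℝ)) := by ring
  rw [cubicCoeff, hα, real_inner_self_eq_norm_sq, inner_hessian_eq x u u hd2,
    real_inner_comm (gradient ρ x) u, real_inner_smul_right, real_inner_comm (gradient ρ x) u]
  rw [norm_smul, mul_pow, Real.norm_eq_abs, sq_abs, real_inner_smul_left,
    ← inner_gradient_eq_fderiv ρ x u] at h1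
  rw [real_inner_smul_left] at h2
  generalize (p - 1) / (m : ℝ) = a at *
  generalize inner ℝ (gradient ρ x) u = q at *
  generalize fderiv ℝ (fderiv ℝ ρ) x u u = h at *
  generalize ‖gradient ρ x‖ = n at *
  -- every power of `ρ x` is expressed through `P = ρ x ^ a`
  have hP : 0 < ρ x ^ a := Real.rpow_pos_of_pos hρx a
  have e1 : ρ x ^ (-a - 1) = (ρ x ^ a * ρ x)⁻¹ := by
    rw [Real.rpow_sub hρx, Real.rpow_neg hρx.le, Real.rpow_one]; field_simp
  have e2 : ρ x ^ (-a - 2) = (ρ x ^ a * ρ x ^ 2)⁻¹ := by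
    rw [Real.rpow_sub hρx, Real.rpow_neg hρx.le, Real.rpow_two]; field_simp
  have e3 : ρ x ^ (2 * a - 1) = (ρ x ^ a) ^ 2 / ρ x := by
    rw [Real.rpow_sub hρx, Real.rpow_one, mul_comm, Real.rpow_mul hρx.le, Real.rpow_two]
  have e4 : ρ x ^ (3 / 2 * (2 * a) - 2) = (ρ x ^ a) ^ 3 / ρ x ^ 2 := by
    rw [Real.rpow_sub hρx, Real.rpow_two, show 3 / 2 * (2 * a) = a * (3 : ℕ) by push_cast; ring,
      Real.rpow_mul hρx.le, Real.rpow_natCast]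
  rw [e1, e2] at h1
  rw [e1] at h2
  rw [e3, e4]
  generalize ρ x ^ a = P at *
  generalize ρ x = R at *
  constructor
  · refine le_trans (le_of_eq ?_) (h1.trans ?_)
    · congr 1
      field_simp
      ring
    · gcongr
      rw [hM]
      linarith [le_abs_self (203 * (256 * N ^ 14) ^ 5 * (16 * N ^ 4)), abs_nonneg (512 * N ^ 15)]
  · refine le_trans (le_of_eq ?_) (h2.trans ?_)
    · congr 1
      field_simp
      ring
    · gcongr
      rw [hM]
      linarith [abs_nonneg (203 * (256 * N ^ 14) ^ 5 * (16 * N ^ 4)), le_abs_self (512 * N ^ 15)]
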